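/- **Setting.** Let $(\mathsf E,\mathsf d)$ be a metric space with a $\sigma$-algebra $\mathscr E$ containing the $\mathsf d$-open sets, and let $\pi$ be a probability measure on $\mathscr E$. For $A\in\mathscr E$ put $A_r=\{x:\mathsf d(x,A)\le r\}$, $\pi^+(A)=\liminf_{r\to0^+}\frac{\pi(A_r)-\pi(A)}{r}$, and $I_\pi(p)=\inf\{\pi^+(A):A\in\mathscr E,\ \pi(A)=p\}$ for $p\in(0,1)$ (with $\inf\emptyset=\infty$). A function $\tilde I_\pi:(0,1)\to(0,\infty)$ is an *isoperimetric minorant* of $\pi$ if $\tilde I_\pi\le I_\pi$ pointwise; it is *regular* if it is symmetric about $\frac12$, continuous, and (weakly) increasing on $(0,\frac12]$. A Markov kernel $P$ is *$(\mathsf d,\delta,\varepsilon)$-close coupling* ($\delta,\varepsilon>0$) if $\mathsf d(x,y)\le\delta$ implies $\|P(x,\cdot)-P(y,\cdot)\|_{\mathrm{TV}}\le1-\varepsilon$, where $\|\mu-\nu\|_{\mathrm{TV}}=\frac12\sup_{|f|\le1}(\mu(f)-\nu(f))$; it is *$\pi$-reversible* if $\int_A P(x,B)\,\pi(\mathrm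 dx)=\int_B P(x,A)\,\pi(\mathrm dx)$ for all $A,B\in\mathscr E$, and it is then *positive* if $\langle f,Pf\rangle_{L^2(\pi)}\ge0$ for all $f\in L^2(\pi)$. Write $\|f\|_{\mathrm{osc}}=\operatorname{ess\,sup}_\pi f-\operatorname{ess\,inf}_\pi f$, $\|\cdot\|_2$ for the norm of $L^2(\pi)$, and $\chi^2(\nu,\pi)=\mathrm{var}_\pi(\mathrm d\nu/\mathrm d\pi)$ for $\nu\ll\pi$ (with $\chi^2=\infty$ if the density does not exist or is not in $L^2(\pi)$). **Theorem.** Let $\tilde I_\pi$ be a regular isoperimetric minorant of $\pi$ that is convex on $(0,\frac12]$; if $\pi$ is concentrated on some $\mathsf d$-bounded set (closed ball), assume also that $\lim_{p\downarrow0}\tilde I_\pi(p)=0$. Let $P$ be a positive, $\pi$-reversible, $(\mathsf d,\delta,\varepsilon)$-close coupling Markov kernel, and assume $2\,\delta\,\tilde I_\pi(\frac14)\le1$. 1. For every $\varepsilon_{\mathrm{Mix}}\in(0,\frac14)$ and every integer $n$ with $$n\ \ge\ 1+2^8\,\varepsilon^{-2}\,\delta^{-2}\int_{2^{-3}\varepsilon_{\mathrm{Mix}}}^{2^{-5}}\frac{v\,\mathrm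 dv}{\tilde I_\pi(v)^2},$$ one has $\sup\{\|P^nf-\pi(f)\|_2^2: f\in L^2(\pi),\ \|f\|_{\mathrm{osc}}^2\le1\}\le\varepsilon_{\mathrm{Mix}}$. 2. Let $\nu\ll\pi$ be a probability measure with $u:=\left\|\frac{\mathrm d\nu}{\mathrm d\pi}\right\|_{\mathrm{osc}}^2<\infty$. For every $\varepsilon_{\mathrm{Mix}}>0$ and every integer $n\ge0$ with $$n\ \ge\ 1+2^8\,\varepsilon^{-2}\,\delta^{-2}\int_{2^{-3}\varepsilon_{\mathrm{Mix}}u^{-1}}^{2^{-5}}\frac{v\,\mathrm dv}{\tilde I_\pi(v)^2},$$ one has $\chi^2(\nu P^n,\pi)\le\varepsilon_{\mathrm{Mix}}$. (If $u=0$ the condition on $n$ is void. If the lower limit of the integral exceeds the upper one, the integral is oriented, hence non-positive, and every $n\ge1$ qualifies.) -/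

import Mathlib

open MeasureTheory ProbabilityTheory Filter Topology Set
open scoped ENNReal

namespace CloseCouplingMixing

noncomputable section

/-- The oscillation seminorm `‖f‖_osc = ess sup_μ f - ess inf_μ f`, with values in `[0, ∞]`. The
essential supremum and infimum are taken in the extended reals, so unbounded functions have
oscillation `∞`. -/
def oscNorm {E : Type*} [MeasurableSpace E] (μ : Measure E) (f : E → ℝ) : ℝ≥0∞ :=
  (essSup (fun x => (f x : EReal)) μ - essInf (fun x => (f x : EReal)) μ).toENNReal

/-- The total variation distance `‖μ - ν‖_TV = (1/2) sup {(μ - ν)(f) : ‖f‖_∞ ≤ 1}` between two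
finite measures. -/
def tvDist {E : Type*} [MeasurableSpace E] (μ ν : Measure E) : ℝ :=
  (1 / 2) * sSup {a : ℝ | ∃ f : E → ℝ, Measurable f ∧ (∀ x, |f x| ≤ 1) ∧
    a = (∫ x, f x ∂μ) - ∫ x, f x ∂ν}

open Classical in
/-- The chi-squared divergence: `χ²(ν, μ) = var_μ (dν/dμ)` if `ν ≪ μ`, with the value `∞` if
`dν/dμ` is not square integrable or `ν` is not absolutely continuous with respect to `μ`. -/
def chiSq {E : Type*} [MeasurableSpace E] (ν μ : Measure E) : ℝ≥0∞ :=
  if ν ≪ μ then evariance (fun x => (ν.rnDeriv μ x).toReal) μ else ∞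

/-- The Minkowski content `π⁺(A) = liminf_{r → 0+} (π(A_r) - π(A)) / r`, where
`A_r = {x | d(x, A) ≤ r}`. Here `π(A) ≤ π(A_r)`, so the truncated subtraction is harmless. -/
def minkowskiContent {E : Type*} [MetricSpace E] [MeasurableSpace E]
    (π : Measure E) (A : Set E) : ℝ≥0∞ :=
  liminf (fun r : ℝ => (π (Metric.cthickening r A) - π A) / ENNReal.ofReal r) (𝓝[>] 0)

/-- The isoperimetric profile `I_π(p) = inf {π⁺(A) : A measurable, π(A) = p}`, with
`inf ∅ = ∞`. -/
def isoProfile {E : Type*} [MetricSpace E] [MeasurableSpace E]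
    (π : Measure E) (p : ℝ) : ℝ≥0∞ :=
  ⨅ (A : Set E) (_ : MeasurableSet A) (_ : π A = ENNReal.ofReal p), minkowskiContent π A

/-- `I : (0, 1) → (0, ∞)` is an isoperimetric minorant of `π`: it lies below the isoperimetric
profile pointwise. Only the values of `I` on `(0, 1)` matter. -/
def IsIsoMinorant {E : Type*} [MetricSpace E] [MeasurableSpace E]
    (π : Measure E) (I : ℝ → ℝ) : Prop :=
  ∀ p ∈ Ioo (0 : ℝ) 1, 0 < I p ∧ ENNReal.ofReal (I p) ≤ isoProfile π p

/-- A function on `(0, 1)` is regular if it is symmetric about `1/2`, continuous, and increasing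
(in the weak sense) on `(0, 1/2]`. -/
structure IsRegular (I : ℝ → ℝ) : Prop where
  symm : ∀ p ∈ Ioo (0 : ℝ) 1, I (1 - p) = I p
  cont : ContinuousOn I (Ioo 0 1)
  mono : MonotoneOn I (Ioc 0 (1 / 2))

/-- The kernel `P` is `(d, δ, ε)`-close coupling, `d` being the metric of `E`. -/
def IsCloseCoupling {E : Type*} [MetricSpace E] [MeasurableSpace E]
    (P : Kernel E E) (δ ε : ℝ) : Prop :=
  0 < δ ∧ 0 < ε ∧ ∀ x y : E, dist x y ≤ δ → tvDist (P x) (P y) ≤ 1 - ε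

/-- The action `Pf(x) = ∫ f(y) P(x, dy)` of a kernel on functions. -/
def act {E : Type*} [MeasurableSpace E] (P : Kernel E E) (f : E → ℝ) (x : E) : ℝ :=
  ∫ y, f y ∂(P x)

/-- Positivity of a `π`-reversible kernel: `⟨f, Pf⟩ ≥ 0` for all `f ∈ L²(π)`. -/
def IsPositive {E : Type*} [MeasurableSpace E] (P : Kernel E E) (π : Measure E) : Prop :=
  ∀ f : E → ℝ, MemLp f 2 π → 0 ≤ ∫ x, f x * act P f x ∂π

end

end CloseCouplingMixing

/-! After an affine normalisation `f` takes values in `[0,1]`, and everything reduces to the decay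
of `v = Var f` under `P`. For a positive reversible kernel one step lowers the variance by at least
the Dirichlet form, which is half of `∫ (f x - f y)²` against `π ⊗ₘ P`.

The Dirichlet form is bounded below through the flow out of sets. By close coupling, points of `A`
and of its complement that both rarely cross the boundary of `A` are more than `δ` apart, so the
isoperimetric inequality puts mass at least `δ I(π A / 2)` on points that do cross
(`min_le_compProd`). Convexity together with `I(0+) = 0` makes `I p / p` increasing (`ratio_mono`);
this turns the bound into `κ (π A - s)` with `κ = ε δ I(s/2) / (4 s)` (`conductance_le`).

A Cheeger inequality that tolerates the defect `s` (`weak_cheeger`) gives `κ² (v - 2 s) ≤ ∫ (f x - f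
y)²`. The choice `s = v/4` yields a variance drop of at least `(ε δ I(v/8))² / (4 v)`. For `b = v/8`
each step therefore uses up at least one unit of the integral of `2⁸ ε⁻² δ⁻² t / I(t)²`; comparing
sum and integral over `[e/8, 1/32]` bounds the number of steps. -/

namespace CloseCouplingMixing

/-! ### Growth of enlargements and consequences for the minorant -/

section Isoperimetry

variable {E : Type*} [MetricSpace E] [MeasurableSpace E] {π : Measure E}
  [IsProbabilityMeasure π] {I : ℝ → ℝ}

lemma measurableSet_cthickening [OpensMeasurableSpace E] (r : ℝ) (S : Set E) :
    MeasurableSet (Metric.cthickening r S) :=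
  Metric.isClosed_cthickening.measurableSet

lemma eventually_lt_measureReal_cthickening {S : Set E} {c : ℝ} (hc : 0 ≤ c)
    (h : ENNReal.ofReal c < minkowskiContent π S) :
    ∀ᶠ s in 𝓝[>] (0 : ℝ), π.real S + c * s < π.real (Metric.cthickening s S) := by
  have h1 := eventually_lt_of_lt_liminf h
  filter_upwards [h1, self_mem_nhdsWithin] with s hs hs0
  have hs0 : 0 < s := hs0
  rw [ENNReal.lt_div_iff_mul_lt (Or.inl (by simpa using hs0)) (Or.inl (by simp)),
    ← ENNReal.ofReal_mul hc] at hs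
  have h3 := (lt_tsub_iff_left).1 hs
  have h4 := (ENNReal.toReal_lt_toReal (by finiteness) (by finiteness)).2 h3
  rw [ENNReal.toReal_add (by finiteness) (by finiteness),
    ENNReal.toReal_ofReal (by positivity)] at h4
  exact h4

lemma IsIsoMinorant.ofReal_le_minkowskiContent (hI : IsIsoMinorant π I) {S : Set E}
    (hS : MeasurableSet S) (h0 : 0 < π.real S) (h1 : π.real S < 1) :
    ENNReal.ofReal (I (π.real S)) ≤ minkowskiContent π S :=
  (hI _ ⟨h0, h1⟩).2.trans (iInf₂_le_of_le S hS (iInf_le _ (by simp)))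

/-- If the profile is at least `c` along the enlargements of `S`, these grow at least with
speed `c`. -/
lemma IsIsoMinorant.measureReal_cthickening_ge [OpensMeasurableSpace E]
    (hI : IsIsoMinorant π I) {S : Set E} {R c : ℝ} (hc : 0 < c)
    (h : ∀ r, 0 ≤ r → r < R → 0 < π.real (Metric.cthickening r S) ∧
      π.real (Metric.cthickening r S) < 1 ∧ c ≤ I (π.real (Metric.cthickening r S)))
    {r : ℝ} (hr0 : 0 ≤ r) (hrR : r < R) :
    π.real S + c * r ≤ π.real (Metric.cthickening r S) := by
  set g : ℝ → ℝ := fun t => π.real (Metric.cthickening t S) with hg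
  have gmono : Monotone g := fun a b hab =>
    measureReal_mono (Metric.cthickening_mono hab S)
  -- A speed `c' < c` leaves room for strict growth just after any time, which the liminf in the
  -- Minkowski content provides. The last time `m` at which growth at speed `c'` is attained must
  -- then be `r`.
  have key : ∀ c', 0 ≤ c' → c' < c → g 0 + c' * r ≤ g r := by
    intro c' hc0 hcc
    set T : Set ℝ := {t | 0 ≤ t ∧ t ≤ r ∧ g 0 + c' * t ≤ g t} with hT
    have hT0 : (0 : ℝ) ∈ T := ⟨le_rfl, hr0, by simp⟩
    have hTb : BddAbove T := ⟨r, fun t ht => ht.2.1⟩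
    set m := sSup T
    have hm0 : 0 ≤ m := le_csSup hTb hT0
    have hmr : m ≤ r := csSup_le ⟨0, hT0⟩ fun t ht => ht.2.1
    -- The supremum is attained because `g` is monotone; no continuity of `g` is needed.
    have hmT : g 0 + c' * m ≤ g m := by
      refine le_of_forall_pos_lt_add fun η hη => ?_
      obtain ⟨t, ht, htm⟩ := exists_lt_of_lt_csSup ⟨0, hT0⟩
        (show m - η / (c' + 1) < m by have : 0 < η / (c' + 1) := by positivity
                                      linarith)
      have h1 : g t ≤ g m := gmono (le_csSup hTb ht)
      have h2 : c' * m ≤ c' * (t + η / (c' + 1)) := by gcongr; linarith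
      have h3 : c' * (η / (c' + 1)) < η := by
        rw [← mul_div_assoc, div_lt_iff₀ (by positivity)]; nlinarith
      have := ht.2.2
      nlinarith
    rcases hmr.eq_or_lt with hmr | hmr
    · rwa [hmr] at hmT
    exfalso
    obtain ⟨a1, a2, a3⟩ := h m hm0 (hmr.trans hrR)
    have h1 := hI.ofReal_le_minkowskiContent (measurableSet_cthickening m S) a1 a2
    have h2 : ENNReal.ofReal c' < minkowskiContent π (Metric.cthickening m S) :=
      lt_of_lt_of_le ((ENNReal.ofReal_lt_ofReal_iff (hc.trans_le a3)).2 (hcc.trans_le a3)) h1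
    have h3 := eventually_lt_measureReal_cthickening hc0 h2
    have h4 : ∀ᶠ s in 𝓝[>] (0 : ℝ), s < r - m :=
      (eventually_lt_nhds (by linarith)).filter_mono nhdsWithin_le_nhds
    obtain ⟨s, hs, hs1, hs0⟩ := (h3.and (h4.and self_mem_nhdsWithin)).exists
    have hs0 : 0 < s := hs0
    have h5 : π.real (Metric.cthickening s (Metric.cthickening m S)) ≤ g (s + m) :=
      measureReal_mono (Metric.cthickening_cthickening_subset hs0.le hm0 S)
    have : s + m ∈ T := ⟨by linarith, by linarith, by
      have : π.real (Metric.cthickening m S) = g m := rfl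
      nlinarith⟩
    have := le_csSup hTb this
    linarith
  have h0 : π.real S ≤ g 0 := measureReal_mono (Metric.self_subset_cthickening S)
  have h1 : g 0 + c * r ≤ g r := by
    refine le_of_forall_pos_lt_add fun η hη => ?_
    by_cases hh : c ≤ η / (r + 1)
    · have : g 0 ≤ g r := gmono hr0
      have : c * r ≤ η / (r + 1) * r := by gcongr
      have : η / (r + 1) * r < η := by
        rw [div_mul_eq_mul_div, div_lt_iff₀ (by positivity)]; nlinarith
      linarith
    · have h2 : 0 < η / (r + 1) := by positivity
      have := key (c - η / (r + 1)) (by linarith) (by linarith)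
      have : η / (r + 1) * r < η := by
        rw [div_mul_eq_mul_div, div_lt_iff₀ (by positivity)]; nlinarith
      linarith
  linarith

lemma IsRegular.le_of_mem_Icc (hreg : IsRegular I) {q p : ℝ} (hq : 0 < q) (hq' : q ≤ 1 / 2)
    (h1 : q ≤ p) (h2 : p ≤ 1 - q) : I q ≤ I p := by
  rcases le_total p (1 / 2) with h | h
  · exact hreg.mono ⟨hq, hq'⟩ ⟨by linarith, h⟩ h1
  · rw [← hreg.symm p ⟨by linarith, by linarith⟩]
    exact hreg.mono ⟨hq, hq'⟩ ⟨by linarith, by linarith⟩ (by linarith)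

/-- Three-set isoperimetric inequality. -/
lemma IsIsoMinorant.three_set [OpensMeasurableSpace E] (hI : IsIsoMinorant π I)
    (hreg : IsRegular I) {S₁ S₂ : Set E}
    {δ q : ℝ} (hδ : 0 < δ) (hS₂ : MeasurableSet S₂)
    (hd : ∀ x ∈ S₁, ∀ y ∈ S₂, δ < dist x y) (hq : 0 < q) (h1 : q ≤ π.real S₁)
    (h2 : q ≤ π.real S₂) : π.real S₁ + π.real S₂ + δ * I q ≤ 1 := by
  -- Before time `δ` the enlargement of `S₁` misses `S₂`, so its mass stays in `[q, 1 - q]`, where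
  -- symmetry and monotonicity give `I ≥ I q`. Time `δ` itself is reached only as a limit.
  have hdisj : ∀ r, r < δ → π.real (Metric.cthickening r S₁) ≤ 1 - π.real S₂ := by
    intro r hr
    rw [← probReal_compl_eq_one_sub hS₂]
    refine measureReal_mono fun y hy hy2 => ?_
    obtain ⟨x, hx, hxy⟩ := Metric.mem_thickening_iff.1
      (Metric.cthickening_subset_thickening' hδ hr S₁ hy)
    have := hd x hx y hy2
    rw [dist_comm] at this
    linarith
  have hmono : ∀ r, π.real S₁ ≤ π.real (Metric.cthickening r S₁) := fun r =>
    measureReal_mono (Metric.self_subset_cthickening S₁)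
  have hq2 : q ≤ 1 / 2 := by have := hdisj 0 hδ; have := hmono 0; linarith
  have hpos : 0 < I q := (hI q ⟨hq, by linarith⟩).1
  have key : ∀ r, 0 ≤ r → r < δ → π.real S₁ + I q * r ≤ 1 - π.real S₂ := by
    intro r h0 hr
    refine le_trans (hI.measureReal_cthickening_ge hpos (R := δ) (fun t ht0 ht => ?_) h0 hr)
      (hdisj r hr)
    have h3 := hdisj t ht
    have h4 := hmono t
    exact ⟨by linarith, by linarith, hreg.le_of_mem_Icc hq hq2 (by linarith) (by linarith)⟩
  have : Tendsto (fun r => π.real S₁ + I q * r) (𝓝[<] δ) (𝓝 (π.real S₁ + I q * δ)) :=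
    (Continuous.tendsto (by fun_prop) δ).mono_left nhdsWithin_le_nhds
  have := le_of_tendsto this (b := 1 - π.real S₂) (by
    filter_upwards [Ioo_mem_nhdsLT hδ] with r hr using key r hr.1.le hr.2)
  linarith

/-- This is `I(0+) = 0`, which is automatic when no ball has full mass: if `I ≥ c` throughout, a
ball of positive mass would grow at speed `c` and exceed mass 1 by time `1/c`, although its
enlargements lie in balls of mass less than 1. -/
lemma IsIsoMinorant.exists_lt [OpensMeasurableSpace E] (hI : IsIsoMinorant π I) (hreg : IsRegular I)
    (hzero : (∃ (x : E) (r : ℝ), π (Metric.closedBall x r) = 1) → Tendsto I (𝓝[>] 0) (𝓝 0))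
    {c : ℝ} (hc : 0 < c) : ∃ η, 0 < η ∧ ∀ p, 0 < p → p < η → I p < c := by
  suffices h : ∃ p, 0 < p ∧ p ≤ 1 / 2 ∧ I p < c by
    obtain ⟨p, h0, h1, h2⟩ := h
    exact ⟨p, h0, fun q hq hqp => (hreg.mono ⟨hq, by linarith⟩ ⟨h0, h1⟩ hqp.le).trans_lt h2⟩
  by_cases hb : ∃ (x : E) (r : ℝ), π (Metric.closedBall x r) = 1
  · have h1 := (hzero hb).eventually_lt_const hc
    have h2 : ∀ᶠ p in 𝓝[>] (0 : ℝ), p ∈ Ioo (0 : ℝ) (1 / 2) := Ioo_mem_nhdsGT (by norm_num)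
    obtain ⟨p, hp, hp'⟩ := (h1.and h2).exists
    exact ⟨p, hp'.1, hp'.2.le, hp⟩
  · push Not at hb
    by_contra! hcon
    have hc' : ∀ p, 0 < p → p < 1 → c ≤ I p := by
      intro p h0 h1
      rcases le_total p (1 / 2) with h | h
      · exact hcon p h0 h
      · rw [← hreg.symm p ⟨h0, h1⟩]; exact hcon _ (by linarith) (by linarith)
    obtain ⟨x⟩ : Nonempty E := π.nonempty_of_neZero
    have hex : ∃ n : ℕ, 0 < π (Metric.closedBall x n) := by
      by_contra! h
      have h2 : π (⋃ n : ℕ, Metric.closedBall x n) = 0 :=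
        measure_iUnion_null fun n => le_antisymm (h n) zero_le
      rw [Metric.iUnion_closedBall_nat] at h2
      simp at h2
    obtain ⟨n, hn⟩ := hex
    have hn' : 0 < π.real (Metric.closedBall x n) := ENNReal.toReal_pos hn.ne' (by finiteness)
    have hR : 0 ≤ 1 / c := by positivity
    have := hI.measureReal_cthickening_ge (S := Metric.closedBall x n) (R := 1 / c + 1) hc
      (fun r hr0 _ => by
        have h0 : 0 < π.real (Metric.cthickening r (Metric.closedBall x n)) :=
          hn'.trans_le (measureReal_mono (Metric.self_subset_cthickening _))
        have h1 : π.real (Metric.cthickening r (Metric.closedBall x n)) < 1 := by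
          refine lt_of_le_of_lt (measureReal_mono (s₂ := Metric.closedBall x (n + (r + 1)))
            fun y hy => ?_) (lt_of_le_of_ne measureReal_le_one fun h => hb x (n + (r + 1)) ?_)
          · obtain ⟨z, hz, hyz⟩ := Metric.mem_thickening_iff.1
              (Metric.cthickening_subset_thickening' (by linarith) (by linarith : r < r + 1) _ hy)
            have := dist_triangle y z x
            rw [Metric.mem_closedBall] at hz ⊢
            linarith
          · rw [← ofReal_measureReal, h, ENNReal.ofReal_one]
        exact ⟨h0, h1, hc' _ h0 h1⟩) hR (by linarith)
    have h2 : c * (1 / c) = 1 := by field_simp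
    have h3 : π.real (Metric.cthickening (1 / c) (Metric.closedBall x n)) ≤ 1 :=
      measureReal_le_one
    linarith

/-- A convex isoperimetric minorant that vanishes at `0` has increasing ratio `I p / p`. -/
lemma IsIsoMinorant.ratio_mono [OpensMeasurableSpace E] (hI : IsIsoMinorant π I)
    (hreg : IsRegular I)
    (hconv : ConvexOn ℝ (Ioc 0 (1 / 2)) I)
    (hzero : (∃ (x : E) (r : ℝ), π (Metric.closedBall x r) = 1) → Tendsto I (𝓝[>] 0) (𝓝 0))
    {q p : ℝ} (hq : 0 < q) (hqp : q ≤ p) (hp : p ≤ 1 / 2) : p * I q ≤ q * I p := by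
  rcases hqp.eq_or_lt with rfl | hqp
  · exact le_rfl
  have hp0 : 0 < p := hq.trans hqp
  have hIp : 0 < I p := (hI p ⟨by linarith, by linarith⟩).1
  have hIq : 0 < I q := (hI q ⟨by linarith, by linarith⟩).1
  refine le_of_forall_pos_lt_add fun c hc => ?_
  obtain ⟨η, hη0, hη⟩ := hI.exists_lt hreg hzero (c := c / p / 2) (by positivity)
  -- `t` is the left end of a chord over `[t, p]` and stands for the limit `t → 0`: the three bounds
  -- make `I t` small, keep `t` to the left of `q`, and make `t * I q ≤ c / 4`.
  set t := min (η / 2) (min (q / 2) (c / I q / 4)) with ht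
  have ht0 : 0 < t := by positivity
  have h1 : I t < c / p / 2 := hη t ht0 (lt_of_le_of_lt (min_le_left _ _) (by linarith))
  have htq : t ≤ q / 2 := (min_le_right _ _).trans (min_le_left _ _)
  have htc : t ≤ c / I q / 4 := (min_le_right _ _).trans (min_le_right _ _)
  have hpt : 0 < p - t := by linarith
  have hb1 : 0 ≤ (p - q) / (p - t) := by apply div_nonneg <;> linarith
  have hb2 : 0 ≤ (q - t) / (p - t) := by apply div_nonneg <;> linarith
  have h2 := hconv.2 (show t ∈ Ioc 0 (1 / 2) from ⟨ht0, by linarith⟩)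
    (show p ∈ Ioc 0 (1 / 2) from ⟨hp0, hp⟩) hb1 hb2 (by field_simp; ring)
  have h3 : (p - q) / (p - t) * t + (q - t) / (p - t) * p = q := by field_simp; ring
  simp only [smul_eq_mul] at h2
  rw [h3] at h2
  have h4 : (p - t) * I q ≤ (p - q) * I t + (q - t) * I p := by
    have := mul_le_mul_of_nonneg_left h2 hpt.le
    refine this.trans_eq ?_
    field_simp
  have h5 : t * I q ≤ c / 4 := by
    calc t * I q ≤ c / I q / 4 * I q := by gcongr
      _ = c / 4 := by field_simp
  have h6 : (p - q) * I t ≤ c / 2 := by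
    calc (p - q) * I t ≤ p * (c / p / 2) :=
          mul_le_mul (by linarith) h1.le (hI t ⟨ht0, by linarith⟩).1.le (by linarith)
      _ = c / 2 := by field_simp
  nlinarith [mul_pos ht0 hIp]

end Isoperimetry

/-! ### Reversibility as symmetry of `π ⊗ₘ P`; total variation on sets -/

section Kernels

variable {E : Type*} [MeasurableSpace E] {π : Measure E} {P : Kernel E E}

lemma map_swap_compProd [IsFiniteMeasure π] [IsMarkovKernel P] (hrev : P.IsReversible π) :
    (π ⊗ₘ P).map Prod.swap = π ⊗ₘ P := by
  refine Measure.ext_prod fun {s t} hs ht => ?_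
  rw [Measure.map_apply measurable_swap (hs.prod ht), Set.preimage_swap_prod,
    Measure.compProd_apply_prod ht hs, Measure.compProd_apply_prod hs ht]
  exact hrev ht hs

lemma integral_swap_compProd [IsFiniteMeasure π] [IsMarkovKernel P] (hrev : P.IsReversible π)
    (F : E × E → ℝ) : ∫ z, F z.swap ∂(π ⊗ₘ P) = ∫ z, F z ∂(π ⊗ₘ P) := by
  conv_rhs => rw [← map_swap_compProd hrev]
  exact (integral_map_equiv MeasurableEquiv.prodComm F).symm

lemma integral_fst_compProd [IsFiniteMeasure π] [IsMarkovKernel P] {f : E → ℝ}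
    (hf : Measurable f) : ∫ z, f z.1 ∂(π ⊗ₘ P) = ∫ x, f x ∂π := by
  conv_rhs => rw [← Measure.fst_compProd π P]
  rw [Measure.fst, integral_map measurable_fst.aemeasurable hf.aestronglyMeasurable]

lemma integral_snd_compProd [IsFiniteMeasure π] [IsMarkovKernel P] (hrev : P.IsReversible π)
    {f : E → ℝ} (hf : Measurable f) : ∫ z, f z.2 ∂(π ⊗ₘ P) = ∫ x, f x ∂π := by
  rw [← integral_fst_compProd (P := P) hf]
  exact integral_swap_compProd hrev fun z => f z.1

lemma measureReal_compProd_prod_comm [IsFiniteMeasure π] [IsMarkovKernel P]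
    (hrev : P.IsReversible π) {A B : Set E} (hA : MeasurableSet A) (hB : MeasurableSet B) :
    (π ⊗ₘ P).real (A ×ˢ B) = (π ⊗ₘ P).real (B ×ˢ A) := by
  simp only [measureReal_def]
  rw [Measure.compProd_apply_prod hA hB, Measure.compProd_apply_prod hB hA, hrev hA hB]

lemma mul_measureReal_le_compProd [IsFiniteMeasure π] [IsMarkovKernel P] {A B C : Set E} {c : ℝ}
    (hA : MeasurableSet A) (hC : MeasurableSet C) (hBA : B ⊆ A)
    (hc : 0 ≤ c) (h : ∀ x ∈ B, c ≤ (P x).real C) :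
    c * π.real B ≤ (π ⊗ₘ P).real (A ×ˢ C) := by
  have h1 : ENNReal.ofReal c * π B ≤ (π ⊗ₘ P) (A ×ˢ C) := by
    rw [Measure.compProd_apply_prod hA hC]
    calc ENNReal.ofReal c * π B = ∫⁻ x in B, ENNReal.ofReal c ∂π := by simp
      _ ≤ ∫⁻ x in B, P x C ∂π := setLIntegral_mono (P.measurable_coe hC) fun x hx => by
          rw [← ofReal_measureReal]; exact ENNReal.ofReal_le_ofReal (h x hx)
      _ ≤ ∫⁻ x in A, P x C ∂π := lintegral_mono_set hBA
  have h2 := ENNReal.toReal_mono (by finiteness) h1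
  rwa [ENNReal.toReal_mul, ENNReal.toReal_ofReal hc] at h2

lemma sub_le_tvDist (μ ν : Measure E) [IsProbabilityMeasure μ] [IsProbabilityMeasure ν]
    {A : Set E} (hA : MeasurableSet A) : μ.real A - ν.real A ≤ tvDist μ ν := by
  -- The test function `±1` on `A` and its complement has integral `2 ρ(A) - 1`; the 2 cancels the
  -- factor 1/2 in `tvDist`.
  set f : E → ℝ := fun x => 2 * A.indicator 1 x - 1 with hf
  have hfm : Measurable f := ((measurable_one.indicator hA).const_mul 2).sub_const 1
  have hfb : ∀ x, |f x| ≤ 1 := fun x => by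
    by_cases hx : x ∈ A <;> simp [hf, hx]
    norm_num
  have hint : ∀ (ρ : Measure E) [IsProbabilityMeasure ρ], ∫ x, f x ∂ρ = 2 * ρ.real A - 1 := by
    intro ρ _
    have hi : Integrable (A.indicator (1 : E → ℝ)) ρ := (integrable_const (1 : ℝ)).indicator hA
    rw [integral_sub (hi.const_mul 2) (integrable_const _), integral_const_mul,
      integral_indicator_one hA]
    simp
  have hb : BddAbove {a : ℝ | ∃ f : E → ℝ, Measurable f ∧ (∀ x, |f x| ≤ 1) ∧
      a = (∫ x, f x ∂μ) - ∫ x, f x ∂ν} := by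
    refine ⟨2, ?_⟩
    rintro a ⟨g, -, hg, rfl⟩
    have h (ρ : Measure E) [IsProbabilityMeasure ρ] : |∫ x, g x ∂ρ| ≤ 1 := by
      have := norm_integral_le_of_norm_le_const (μ := ρ) (f := g) (C := 1) (.of_forall hg)
      simpa using this
    have h1 := abs_le.1 (h μ)
    have h2 := abs_le.1 (h ν)
    linarith
  have := le_csSup hb ⟨f, hfm, hfb, rfl⟩
  rw [hint μ, hint ν] at this
  rw [tvDist]
  linarith

end Kernels

/-! ### From isoperimetry to conductance -/

section Conductance

variable {E : Type*} [MetricSpace E] [MeasurableSpace E] [OpensMeasurableSpace E]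
  {π : Measure E} [IsProbabilityMeasure π] {I : ℝ → ℝ} {P : Kernel E E} [IsMarkovKernel P]
  {δ ε : ℝ}

/-- Flow of a close coupling kernel out of a set. -/
lemma min_le_compProd (hI : IsIsoMinorant π I) (hreg : IsRegular I) (hrev : P.IsReversible π)
    (hcc : IsCloseCoupling P δ ε) {A : Set E} (hA : MeasurableSet A) (h0 : 0 < π.real A)
    (h1 : π.real A ≤ 1 / 2) :
    ε / 4 * min (π.real A) (δ * I (π.real A / 2)) ≤ (π ⊗ₘ P).real (A ×ˢ Aᶜ) := by
  obtain ⟨hδ, hε, hcc⟩ := hcc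
  have hm : ∀ {B : Set E}, MeasurableSet B → Measurable fun x => (P x).real B := fun hB =>
    (P.measurable_coe hB).ennreal_toReal
  -- The points unlikely to enter the complement of `A`, respectively `A`. If `A ∩ L₁` or `Aᶜ ∩ L₂`
  -- has mass below `π A / 2`, the points left over on that side already carry flow `ε/4 * π A`.
  -- Otherwise the three-set inequality applies, and the mass outside both sets splits into two
  -- parts, each of which bounds the same flow by reversibility.
  set L₁ : Set E := {x | (P x).real Aᶜ < ε / 2} with hL₁
  set L₂ : Set E := {x | (P x).real A < ε / 2} with hL₂
  have mL₁ : MeasurableSet L₁ := measurableSet_lt (hm hA.compl) measurable_const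
  have mL₂ : MeasurableSet L₂ := measurableSet_lt (hm hA) measurable_const
  have q1 : ε / 2 * π.real (A \ L₁) ≤ (π ⊗ₘ P).real (A ×ˢ Aᶜ) :=
    mul_measureReal_le_compProd hA hA.compl sdiff_subset (by positivity)
      fun x hx => not_lt.1 hx.2
  have q2 : ε / 2 * π.real (Aᶜ \ L₂) ≤ (π ⊗ₘ P).real (A ×ˢ Aᶜ) := by
    rw [measureReal_compProd_prod_comm hrev hA hA.compl]
    exact mul_measureReal_le_compProd hA.compl hA sdiff_subset (by positivity)
      fun x hx => not_lt.1 hx.2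
  have e1 := measureReal_inter_add_sdiff (μ := π) (s := A) mL₁
  have e2 := measureReal_inter_add_sdiff (μ := π) (s := Aᶜ) mL₂
  have e3 := probReal_compl_eq_one_sub (μ := π) hA
  have m1 : ε / 4 * min (π.real A) (δ * I (π.real A / 2)) ≤ ε / 4 * π.real A := by
    gcongr; exact min_le_left _ _
  have m2 : ε / 4 * min (π.real A) (δ * I (π.real A / 2)) ≤ ε / 4 * (δ * I (π.real A / 2)) := by
    gcongr; exact min_le_right _ _
  by_cases c1 : π.real (A ∩ L₁) < π.real A / 2
  · nlinarith
  by_cases c2 : π.real (Aᶜ ∩ L₂) < π.real A / 2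
  · nlinarith
  push Not at c1 c2
  -- Two such points within distance `δ` would satisfy `P x A - P y A > 1 - ε`.
  have h3 := hI.three_set hreg (S₁ := A ∩ L₁) (S₂ := Aᶜ ∩ L₂) hδ (hA.compl.inter mL₂) (by
    intro x hx y hy
    by_contra! hxy
    have k1 := (sub_le_tvDist (P x) (P y) hA).trans (hcc x y hxy)
    have k2 : (P x).real Aᶜ < ε / 2 := hx.2
    have k3 : (P y).real A < ε / 2 := hy.2
    rw [probReal_compl_eq_one_sub hA] at k2
    linarith) (half_pos h0) c1 c2
  nlinarith

/-- For `π A ≤ s` the left side is nonpositive. Otherwise monotonicity of `I p / p` is used twice: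
against `1/4`, where the assumption on `δ` makes the minimum in `min_le_compProd` equal to `δ I(π A
/ 2)`, and against `s / 2`, to make the bound linear in `π A`. -/
lemma conductance_le (hI : IsIsoMinorant π I) (hreg : IsRegular I)
    (hconv : ConvexOn ℝ (Ioc 0 (1 / 2)) I)
    (hzero : (∃ (x : E) (r : ℝ), π (Metric.closedBall x r) = 1) → Tendsto I (𝓝[>] 0) (𝓝 0))
    (hrev : P.IsReversible π) (hcc : IsCloseCoupling P δ ε) (hδ : 2 * δ * I (1 / 4) ≤ 1)
    {s : ℝ} (hs : 0 < s) (hs' : s ≤ 1 / 2) {A : Set E} (hA : MeasurableSet A)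
    (h1 : π.real A ≤ 1 / 2) :
    ε * δ * I (s / 2) / (4 * s) * (π.real A - s) ≤ (π ⊗ₘ P).real (A ×ˢ Aᶜ) := by
  have hδ0 := hcc.1
  have hε0 := hcc.2.1
  rcases le_or_gt (π.real A) s with hps | hps
  · have := (hI (s / 2) ⟨by linarith, by linarith⟩).1
    exact (mul_nonpos_of_nonneg_of_nonpos (by positivity) (by linarith)).trans measureReal_nonneg
  set p := π.real A
  have hp0 : 0 < p := hs.trans hps
  have hIs := (hI (s / 2) ⟨by linarith, by linarith⟩).1
  refine le_trans ?_ (min_le_compProd hI hreg hrev hcc hA hp0 h1)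
  have r1 := hI.ratio_mono hreg hconv hzero (q := p / 2) (p := 1 / 4) (by linarith) (by linarith)
    (by norm_num)
  have r2 := hI.ratio_mono hreg hconv hzero (q := s / 2) (p := p / 2) (by linarith) (by linarith)
    (by linarith)
  have hmin : min p (δ * I (p / 2)) = δ * I (p / 2) := min_eq_right (by nlinarith)
  rw [hmin]
  have : ε * δ * I (s / 2) / (4 * s) * (p - s) ≤ ε * δ * I (s / 2) / (4 * s) * p := by
    gcongr; linarith
  refine this.trans ?_
  rw [div_mul_eq_mul_div, div_le_iff₀ (by positivity)]
  have := mul_le_mul_of_nonneg_left r2 (mul_pos hε0 hδ0).le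
  linarith

end Conductance

/-! ### Coarea formula and the Cheeger inequality with defect -/

section Cheeger

variable {E : Type*} [MeasurableSpace E] {π : Measure E}

/-- The positive part of `b - a` is the length of `[a, b)`; Tonelli then exchanges the integrals. -/
lemma lintegral_ofReal_sub {Ω : Type*} [MeasurableSpace Ω] (μ : Measure Ω) [SFinite μ]
    {a b : Ω → ℝ} (ha : Measurable a) (hb : Measurable b) :
    ∫⁻ ω, ENNReal.ofReal (b ω - a ω) ∂μ = ∫⁻ t : ℝ, μ {ω | a ω ≤ t ∧ t < b ω} := by
  have hD : MeasurableSet {z : Ω × ℝ | a z.1 ≤ z.2 ∧ z.2 < b z.1} :=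
    (measurableSet_le (ha.comp measurable_fst) measurable_snd).inter
      (measurableSet_lt measurable_snd (hb.comp measurable_fst))
  have h1 := Measure.prod_apply (μ := μ) (ν := (volume : Measure ℝ)) hD
  rw [Measure.prod_apply_symm hD] at h1
  refine Eq.trans ?_ h1.symm
  refine lintegral_congr fun ω => ?_
  rw [← Real.volume_Ico]
  rfl

lemma integrable_of_abs_le {Ω : Type*} [MeasurableSpace Ω] (μ : Measure Ω) [IsFiniteMeasure μ]
    {h : Ω → ℝ} (hh : Measurable h) {C : ℝ} (hC : ∀ x, |h x| ≤ C) : Integrable h μ :=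
  .of_bound hh.aestronglyMeasurable C (.of_forall hC)

lemma abs_mul_abs_sub_le (a b : ℝ) : |a * |a| - (b * |b|)| ≤ |a - b| * (|a| + |b|) := by
  rcases abs_cases a with ⟨h1, _⟩ | ⟨h1, _⟩ <;> rcases abs_cases b with ⟨h2, _⟩ | ⟨h2, _⟩ <;>
    rcases abs_cases (a - b) with ⟨h3, _⟩ | ⟨h3, _⟩ <;> rw [h1, h2, h3, abs_le] <;>
    constructor <;> nlinarith

lemma measureReal_iUnion_le [IsProbabilityMeasure π] {A : ℕ → Set E} (hA : Monotone A) {c : ℝ}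
    (h : ∀ n, π.real (A n) ≤ c) : π.real (⋃ n, A n) ≤ c := by
  have h1 := (ENNReal.tendsto_toReal (measure_ne_top π _)).comp
    (tendsto_measure_iUnion_atTop (μ := π) hA)
  exact le_of_tendsto' h1 h

/-- The infimum of the levels `t` with `π {f > t} ≤ 1/2` works: both strict level sets are
increasing unions of sets of mass at most `1/2`. -/
lemma exists_median [IsProbabilityMeasure π] {f : E → ℝ} (hf : Measurable f)
    (h01 : ∀ x, f x ∈ Icc (0 : ℝ) 1) :
    ∃ m ∈ Icc (0 : ℝ) 1, π.real {x | m < f x} ≤ 1 / 2 ∧ π.real {x | f x < m} ≤ 1 / 2 := by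
  set S : Set ℝ := {t | 0 ≤ t ∧ π.real {x | t < f x} ≤ 1 / 2} with hS
  have h1 : (1 : ℝ) ∈ S := by
    refine ⟨zero_le_one, ?_⟩
    have : {x | 1 < f x} = ∅ := by ext x; simpa using (h01 x).2
    simp [this]
  have hb : BddBelow S := ⟨0, fun t ht => ht.1⟩
  set m := sInf S with hm
  have hm0 : 0 ≤ m := le_csInf ⟨1, h1⟩ fun t ht => ht.1
  obtain ⟨u, humono, hum, hu⟩ := exists_seq_strictAnti_tendsto m
  obtain ⟨v, hvmono, hvm, hv⟩ := exists_seq_strictMono_tendsto m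
  refine ⟨m, ⟨hm0, csInf_le hb h1⟩, ?_, ?_⟩
  · have key : ∀ t, m < t → π.real {x | t < f x} ≤ 1 / 2 := by
      intro t ht
      obtain ⟨s, hs, hst⟩ := exists_lt_of_csInf_lt ⟨1, h1⟩ ht
      exact (measureReal_mono fun x (hx : t < f x) => hst.trans hx).trans hs.2
    have hU : {x | m < f x} = ⋃ n, {x | u n < f x} := by
      ext x
      simp only [mem_ofPred_eq, mem_iUnion]
      refine ⟨fun hx => (hu.eventually_lt_const hx).exists, fun ⟨n, hn⟩ => (hum n).trans hn⟩
    rw [hU]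
    refine measureReal_iUnion_le (fun i j hij x (hx : u i < f x) => ?_) fun n => key _ (hum n)
    exact lt_of_le_of_lt (humono.antitone hij) hx
  · have key : ∀ t, t < m → π.real {x | f x ≤ t} ≤ 1 / 2 := by
      intro t ht
      rcases lt_or_ge t 0 with h0 | h0
      · have : {x | f x ≤ t} = ∅ := by
          ext x; simpa using h0.trans_le (h01 x).1
        simp [this]
      · have h2 : 1 / 2 < π.real {x | t < f x} := by
          by_contra! h
          exact absurd (csInf_le hb (show t ∈ S from ⟨h0, h⟩)) (not_le.2 ht)
        have h3 := probReal_compl_eq_one_sub (μ := π) (measurableSet_lt measurable_const hf :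
          MeasurableSet {x | t < f x})
        have h4 : {x | t < f x}ᶜ = {x | f x ≤ t} := by ext x; simp
        rw [h4] at h3
        linarith
    have hU : {x | f x < m} = ⋃ n, {x | f x ≤ v n} := by
      ext x
      simp only [mem_ofPred_eq, mem_iUnion]
      refine ⟨fun hx => ?_, fun ⟨n, hn⟩ => hn.trans_lt (hvm n)⟩
      obtain ⟨n, hn⟩ := (hv.eventually_const_lt hx).exists
      exact ⟨n, hn.le⟩
    rw [hU]
    exact measureReal_iUnion_le (fun i j hij x (hx : f x ≤ v i) => hx.trans (hvmono.monotone hij))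
      fun n => key _ (hvm n)

/-- Conductance bound integrated over the level sets of a function with median `0`. -/
lemma coarea_le [IsProbabilityMeasure π] {P : Kernel E E} [IsMarkovKernel P]
    (hrev : P.IsReversible π) {κ s : ℝ} (hκ : 0 ≤ κ) (hs : 0 ≤ s)
    (hQ : ∀ A, MeasurableSet A → π.real A ≤ 1 / 2 →
      κ * (π.real A - s) ≤ (π ⊗ₘ P).real (A ×ˢ Aᶜ))
    {F : E → ℝ} (hF : Measurable F) {a b : ℝ} (hab : b - a ≤ 1) (hFab : ∀ x, F x ∈ Icc a b)
    (hr : π.real {x | 0 < F x} ≤ 1 / 2) (hl : π.real {x | F x < 0} ≤ 1 / 2) :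
    ENNReal.ofReal κ * ((∫⁻ x, ENNReal.ofReal (F x - 0) ∂π) +
      ∫⁻ x, ENNReal.ofReal (0 - F x) ∂π) ≤
      (∫⁻ z, ENNReal.ofReal (F z.1 - F z.2) ∂(π ⊗ₘ P)) + ENNReal.ofReal (κ * s) := by
  have hQ' : ∀ A, MeasurableSet A → π.real A ≤ 1 / 2 →
      ENNReal.ofReal κ * π A ≤ (π ⊗ₘ P) (A ×ˢ Aᶜ) + ENNReal.ofReal (κ * s) := by
    intro A hA h
    rw [← ofReal_measureReal (μ := π), ← ofReal_measureReal (μ := π ⊗ₘ P),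
      ← ENNReal.ofReal_mul hκ, ← ENNReal.ofReal_add measureReal_nonneg (by positivity)]
    exact ENNReal.ofReal_le_ofReal (by linarith [hQ A hA h])
  -- The conductance is applied to `{F > t}` for `t ≥ 0` and to `{F ≤ t}` for `t < 0`, the side of
  -- mass at most `1/2`. The defect is paid only for `t` in `[a, b)`, since outside it that set is
  -- empty; as `b - a ≤ 1`, the total cost is at most `κ s`.
  have key : ∀ t : ℝ, ENNReal.ofReal κ * (π {x | 0 ≤ t ∧ t < F x} + π {x | F x ≤ t ∧ t < 0}) ≤
      (π ⊗ₘ P) {z | F z.2 ≤ t ∧ t < F z.1} +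
        (Ico a b).indicator (fun _ => ENNReal.ofReal (κ * s)) t := by
    intro t
    have mA : MeasurableSet {x | t < F x} := measurableSet_lt measurable_const hF
    have eA : {z : E × E | F z.2 ≤ t ∧ t < F z.1} = {x | t < F x} ×ˢ {x | t < F x}ᶜ := by
      ext z; simp [and_comm]
    have cA : {x | F x ≤ t}ᶜ = {x | t < F x} := by ext x; simp
    have cA' : {x | t < F x}ᶜ = {x | F x ≤ t} := by ext x; simp
    have eA' : (π ⊗ₘ P) ({x | t < F x} ×ˢ {x | t < F x}ᶜ) =
        (π ⊗ₘ P) ({x | F x ≤ t} ×ˢ {x | F x ≤ t}ᶜ) := by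
      rw [cA, cA', Measure.compProd_apply_prod mA (cA' ▸ mA.compl),
        Measure.compProd_apply_prod (cA' ▸ mA.compl) mA, hrev mA (cA' ▸ mA.compl)]
    rw [eA]
    rcases le_or_gt 0 t with h0 | h0
    · have e1 : {x | F x ≤ t ∧ t < 0} = ∅ := by
        ext x; simp only [mem_ofPred_eq, mem_empty_iff_false, iff_false]; intro h; linarith [h.2]
      have e2 : {x | 0 ≤ t ∧ t < F x} = {x | t < F x} := by ext x; simp [h0]
      rw [e1, e2, measure_empty, add_zero]
      have hsub : {x | t < F x} ⊆ {x | 0 < F x} := fun x (hx : t < F x) => lt_of_le_of_lt h0 hx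
      by_cases ht : t < b
      · rcases lt_or_ge t a with hta | hta
        · have : π.real {x | t < F x} = 1 := by
            have : {x | t < F x} = univ := by
              ext x; simpa using hta.trans_le (hFab x).1
            simp [this]
          have := measureReal_mono (μ := π) hsub
          linarith
        rw [indicator_of_mem (show t ∈ Ico a b from ⟨hta, ht⟩)]
        exact hQ' _ mA ((measureReal_mono hsub).trans hr)
      · have : {x | t < F x} = ∅ := by
          ext x; simpa using (hFab x).2.trans (not_lt.1 ht)
        simp [this]
    · have e1 : {x | 0 ≤ t ∧ t < F x} = ∅ := by
        ext x; simp only [mem_ofPred_eq, mem_empty_iff_false, iff_false]; intro h; linarith [h.1]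
      have e2 : {x | F x ≤ t ∧ t < 0} = {x | F x ≤ t} := by ext x; simp [h0]
      rw [e1, e2, measure_empty, zero_add, eA']
      have hsub : {x | F x ≤ t} ⊆ {x | F x < 0} := fun x (hx : F x ≤ t) => lt_of_le_of_lt hx h0
      by_cases ht : a ≤ t
      · rcases le_or_gt b t with hta | hta
        · have : π.real {x | F x ≤ t} = 1 := by
            have : {x | F x ≤ t} = univ := by
              ext x; simpa using (hFab x).2.trans hta
            simp [this]
          have := measureReal_mono (μ := π) hsub
          linarith
        rw [indicator_of_mem (show t ∈ Ico a b from ⟨ht, hta⟩)]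
        exact hQ' _ (cA' ▸ mA.compl) ((measureReal_mono hsub).trans hl)
      · have : {x | F x ≤ t} = ∅ := by
          ext x; simpa using (not_le.1 ht).trans_le (hFab x).1
        simp [this]
  have h1 := lintegral_ofReal_sub (π ⊗ₘ P) (hF.comp measurable_snd) (hF.comp measurable_fst)
  simp only [Function.comp_apply] at h1
  have m1 : Measurable fun t : ℝ => π {x | 0 ≤ t ∧ t < F x} :=
    measurable_measure_prodMk_left ((measurableSet_le measurable_const measurable_fst).inter
      (measurableSet_lt measurable_fst (hF.comp measurable_snd)) :
      MeasurableSet {z : ℝ × E | 0 ≤ z.1 ∧ z.1 < F z.2})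
  have m2 : Measurable fun t : ℝ => (Ico a b).indicator (fun _ => ENNReal.ofReal (κ * s)) t :=
    measurable_const.indicator measurableSet_Ico
  rw [lintegral_ofReal_sub π measurable_const hF, lintegral_ofReal_sub π hF measurable_const, h1,
    ← lintegral_add_left m1, ← lintegral_const_mul' _ _ ENNReal.ofReal_ne_top]
  refine (lintegral_mono key).trans ?_
  rw [lintegral_add_right _ m2]
  gcongr
  rw [lintegral_indicator measurableSet_Ico, setLIntegral_const, Real.volume_Ico]
  calc ENNReal.ofReal (κ * s) * ENNReal.ofReal (b - a) ≤ ENNReal.ofReal (κ * s) * 1 := by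
        gcongr; rw [← ENNReal.ofReal_one]; exact ENNReal.ofReal_le_ofReal hab
    _ = _ := mul_one _

/-- Weak Cheeger inequality. -/
lemma weak_cheeger [IsProbabilityMeasure π] {P : Kernel E E} [IsMarkovKernel P]
    (hrev : P.IsReversible π) {κ s : ℝ} (hκ : 0 < κ) (hs : 0 ≤ s)
    (hQ : ∀ A, MeasurableSet A → π.real A ≤ 1 / 2 →
      κ * (π.real A - s) ≤ (π ⊗ₘ P).real (A ×ˢ Aᶜ))
    {f : E → ℝ} (hf : Measurable f) (h01 : ∀ x, f x ∈ Icc (0 : ℝ) 1) :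
    κ ^ 2 * (Var[f; π] - 2 * s) ≤ ∫ z, (f z.1 - f z.2) ^ 2 ∂(π ⊗ₘ P) := by
  obtain ⟨m, ⟨hm0, hm1⟩, hmr, hml⟩ := exists_median (π := π) hf h01
  set μ := π ⊗ₘ P with hμ
  set g : E → ℝ := fun x => f x - m with hg
  have hgm : Measurable g := hf.sub_const m
  have hgb : ∀ x, |g x| ≤ 1 := fun x => abs_le.2 ⟨by have := (h01 x).1; simp only [hg]; linarith,
    by have := (h01 x).2; simp only [hg]; linarith⟩
  -- The signed square keeps median 0, satisfies `|F| = g²`, and has range in an interval of length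
  -- `m² + (1 - m)² ≤ 1`.
  set F : E → ℝ := fun x => g x * |g x| with hF
  have hFm : Measurable F := hgm.mul hgm.abs
  have hFabs : ∀ x, |F x| = g x ^ 2 := fun x => by
    simp only [hF, abs_mul, abs_abs]; rw [← sq, sq_abs]
  have hFb : ∀ x, |F x| ≤ 1 := fun x => by
    rw [hFabs, ← sq_abs]; exact pow_le_one₀ (abs_nonneg _) (hgb x)
  have iF1 : Integrable (fun z : E × E => F z.1) μ :=
    integrable_of_abs_le μ (hFm.comp measurable_fst) fun z => hFb z.1
  have iF2 : Integrable (fun z : E × E => F z.2) μ :=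
    integrable_of_abs_le μ (hFm.comp measurable_snd) fun z => hFb z.2
  have iD : Integrable (fun z : E × E => F z.1 - F z.2) μ := iF1.sub iF2
  have ig : Integrable (fun x => g x ^ 2) π :=
    integrable_of_abs_le π (hgm.pow_const 2) (C := 1) fun x => by
    rw [← hFabs, abs_abs]; exact hFb x
  -- coarea formula and conductance
  have coarea : ENNReal.ofReal κ * ((∫⁻ x, ENNReal.ofReal (F x - 0) ∂π) +
      ∫⁻ x, ENNReal.ofReal (0 - F x) ∂π) ≤
      (∫⁻ z, ENNReal.ofReal (F z.1 - F z.2) ∂μ) + ENNReal.ofReal (κ * s) := by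
    have hFab : ∀ x, F x ∈ Icc (-m ^ 2) ((1 - m) ^ 2) := by
      intro x
      have h1 : -m ≤ g x := by have := (h01 x).1; simp only [hg]; linarith
      have h2 : g x ≤ 1 - m := by have := (h01 x).2; simp only [hg]; linarith
      simp only [hF, mem_Icc]
      rcases le_total 0 (g x) with h | h
      · rw [abs_of_nonneg h]; constructor <;> nlinarith
      · rw [abs_of_nonpos h]; constructor <;> nlinarith
    refine coarea_le hrev hκ.le hs hQ hFm (by nlinarith) hFab (le_trans (measureReal_mono ?_) hmr)
      (le_trans (measureReal_mono ?_) hml)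
    · intro x (hx : 0 < g x * |g x|)
      have : 0 < g x := pos_of_mul_pos_left hx (abs_nonneg _)
      simpa [hg] using this
    · intro x (hx : g x * |g x| < 0)
      have : g x < 0 := by
        by_contra! h
        exact absurd hx (not_lt.2 (mul_nonneg h (abs_nonneg _)))
      simpa [hg] using this
  have pos1 : ∫⁻ x, ENNReal.ofReal (F x - 0) ∂π + ∫⁻ x, ENNReal.ofReal (0 - F x) ∂π
      = ENNReal.ofReal (∫ x, g x ^ 2 ∂π) := by
    rw [← lintegral_add_left (by fun_prop), ofReal_integral_eq_lintegral_ofReal ig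
      (.of_forall fun x => sq_nonneg _)]
    refine lintegral_congr fun x => ?_
    rw [← hFabs]
    rcases le_total 0 (F x) with h | h
    · rw [abs_of_nonneg h, ENNReal.ofReal_of_nonpos (p := 0 - F x) (by linarith)]; simp
    · rw [abs_of_nonpos h, ENNReal.ofReal_of_nonpos (p := F x - 0) (by linarith)]; simp
  have pos2 : ∫⁻ z, ENNReal.ofReal (F z.1 - F z.2) ∂μ
      = ENNReal.ofReal ((∫ z, |F z.1 - F z.2| ∂μ) / 2) := by
    have e1 : ∫ z, |F z.1 - F z.2| ∂μ = 2 * ∫ z, max (F z.1 - F z.2) 0 ∂μ := by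
      have e2 : ∫ z, max (F z.2 - F z.1) 0 ∂μ = ∫ z, max (F z.1 - F z.2) 0 ∂μ :=
        integral_swap_compProd hrev fun z => max (F z.1 - F z.2) 0
      rw [two_mul]
      nth_rewrite 2 [← e2]
      have iD' : Integrable (fun z : E × E => F z.2 - F z.1) μ := iF2.sub iF1
      rw [← integral_add iD.pos_part iD'.pos_part]
      refine integral_congr_ae (.of_forall fun z => ?_)
      simp only
      rcases le_total (F z.1) (F z.2) with h | h
      · rw [abs_of_nonpos (by linarith), max_eq_right (by linarith), max_eq_left (by linarith)]
        ring
      · rw [abs_of_nonneg (by linarith), max_eq_left (by linarith), max_eq_right (by linarith)]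
        ring
    rw [e1, mul_div_cancel_left₀ _ two_ne_zero, ofReal_integral_eq_lintegral_ofReal iD.pos_part
      (.of_forall fun z => le_max_right _ _)]
    refine lintegral_congr fun z => ?_
    rw [ENNReal.ofReal_max]
    simp
  have hκw : 2 * κ * ((∫ x, g x ^ 2 ∂π) - s) ≤ ∫ z, |F z.1 - F z.2| ∂μ := by
    rw [pos1, pos2, ← ENNReal.ofReal_mul hκ.le, ← ENNReal.ofReal_add
      (by have : 0 ≤ ∫ z, |F z.1 - F z.2| ∂μ := integral_nonneg fun z => abs_nonneg _
          positivity) (by positivity), ENNReal.ofReal_le_ofReal_iff (by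
      have : 0 ≤ ∫ z, |F z.1 - F z.2| ∂μ := integral_nonneg fun z => abs_nonneg _
      positivity)] at coarea
    linarith
  have ig1 : Integrable (fun z : E × E => g z.1 ^ 2) μ :=
    integrable_of_abs_le μ ((hgm.comp measurable_fst).pow_const 2) (C := 1) fun z => by
      rw [← hFabs, abs_abs]; exact hFb _
  have ig2 : Integrable (fun z : E × E => g z.2 ^ 2) μ :=
    integrable_of_abs_le μ ((hgm.comp measurable_snd).pow_const 2) (C := 1) fun z => by
      rw [← hFabs, abs_abs]; exact hFb _
  have idf : Integrable (fun z : E × E => (f z.1 - f z.2) ^ 2) μ :=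
    integrable_of_abs_le μ
      (((hf.comp measurable_fst).sub (hf.comp measurable_snd)).pow_const 2) (C := 1)
      fun z => by
      have h1 := h01 z.1
      have h2 := h01 z.2
      rw [abs_of_nonneg (sq_nonneg _), ← sq_abs]
      exact pow_le_one₀ (abs_nonneg _) (abs_le.2
        ⟨by linarith [h1.1, h2.2], by linarith [h1.2, h2.1]⟩)
  -- Young's inequality with weight chosen so that only `κ² ∫ g²` is lost, half of the `2 κ² ∫ g²`
  -- in `κ` times `hκw`. Halving the main term but not the defect is what produces `2 s`.
  have hcs : κ * ∫ z, |F z.1 - F z.2| ∂μ ≤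
      (∫ z, (f z.1 - f z.2) ^ 2 ∂μ) + κ ^ 2 * ∫ x, g x ^ 2 ∂π := by
    have h1 : ∫ z, g z.1 ^ 2 ∂μ = ∫ x, g x ^ 2 ∂π := integral_fst_compProd (hgm.pow_const 2)
    have h2 : ∫ z, g z.2 ^ 2 ∂μ = ∫ x, g x ^ 2 ∂π := integral_snd_compProd hrev (hgm.pow_const 2)
    have h3 : κ ^ 2 * ∫ x, g x ^ 2 ∂π = ∫ z, κ ^ 2 / 2 * (g z.1 ^ 2 + g z.2 ^ 2) ∂μ := by
      rw [integral_const_mul, integral_add ig1 ig2, h1, h2]; ring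
    have i4 : Integrable (fun z : E × E => κ ^ 2 / 2 * (g z.1 ^ 2 + g z.2 ^ 2)) μ :=
      (ig1.add ig2).const_mul _
    rw [h3, ← integral_add idf i4, ← integral_const_mul]
    refine integral_mono (iD.abs.const_mul κ) (idf.add i4) fun z => ?_
    have h4 : |F z.1 - F z.2| ≤ |f z.1 - f z.2| * (|g z.1| + |g z.2|) := by
      have h5 : f z.1 - f z.2 = g z.1 - g z.2 := by simp only [hg]; ring
      rw [h5]
      exact abs_mul_abs_sub_le _ _
    have h6 := mul_le_mul_of_nonneg_left h4 hκ.le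
    have h7 := sq_nonneg (|f z.1 - f z.2| - κ / 2 * (|g z.1| + |g z.2|))
    have h8 := sq_nonneg (κ * (|g z.1| - |g z.2|))
    have h9 := sq_abs (f z.1 - f z.2)
    have h10 := sq_abs (g z.1)
    have h11 := sq_abs (g z.2)
    rw [← h9, ← h10, ← h11]
    nlinarith
  have hvar : Var[f; π] ≤ ∫ x, g x ^ 2 ∂π := by
    have h2 : MemLp g 2 π := .of_bound hgm.aestronglyMeasurable 1 (.of_forall hgb)
    rw [← variance_sub_const hf.aestronglyMeasurable m, variance_eq_sub h2]
    have := sq_nonneg (∫ x, g x ∂π)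
    simp only [Pi.pow_apply]
    linarith
  have h1 := mul_le_mul_of_nonneg_left hκw hκ.le
  have h2 := mul_le_mul_of_nonneg_left hvar (sq_nonneg κ)
  nlinarith

end Cheeger

/-! ### The kernel as an operator: self-adjointness and variance decay -/

section Action

variable {E : Type*} [MeasurableSpace E] {π : Measure E} {P : Kernel E E}

lemma measurable_act {f : E → ℝ} (hf : Measurable f) : Measurable (act P f) :=
  hf.stronglyMeasurable.integral_kernel.measurable

lemma abs_act_le [IsMarkovKernel P] {f : E → ℝ} {C : ℝ} (hC : ∀ x, |f x| ≤ C) (x : E) :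
    |act P f x| ≤ C := by
  have := norm_integral_le_of_norm_le_const (μ := P x) (f := f) (C := C) (.of_forall hC)
  simpa [act] using this

lemma act_mem_Icc [IsMarkovKernel P] {f : E → ℝ} (h01 : ∀ x, f x ∈ Icc (0 : ℝ) 1) (x : E) :
    act P f x ∈ Icc (0 : ℝ) 1 := by
  have habs : ∀ x, |f x| ≤ 1 := fun x => abs_le.2 ⟨by linarith [(h01 x).1], (h01 x).2⟩
  exact ⟨integral_nonneg fun y => (h01 y).1, (abs_le.1 (abs_act_le habs x)).2⟩

lemma act_sub [IsMarkovKernel P] {f g : E → ℝ} (hf : Measurable f) (hg : Measurable g) {C D : ℝ}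
    (hC : ∀ x, |f x| ≤ C) (hD : ∀ x, |g x| ≤ D) (x : E) :
    act P (fun y => f y - g y) x = act P f x - act P g x :=
  integral_sub (integrable_of_abs_le _ hf hC) (integrable_of_abs_le _ hg hD)

lemma integral_mul_act [IsFiniteMeasure π] [IsMarkovKernel P] {f g : E → ℝ} (hf : Measurable f)
    (hg : Measurable g) {C D : ℝ} (hC : ∀ x, |f x| ≤ C) (hD : ∀ x, |g x| ≤ D) :
    ∫ x, f x * act P g x ∂π = ∫ z, f z.1 * g z.2 ∂(π ⊗ₘ P) := by
  have hi : Integrable (fun z : E × E => f z.1 * g z.2) (π ⊗ₘ P) :=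
    integrable_of_abs_le _ ((hf.comp measurable_fst).mul (hg.comp measurable_snd)) (C := C * D)
      fun z => by
        rw [abs_mul]
        exact mul_le_mul (hC _) (hD _) (abs_nonneg _) ((abs_nonneg _).trans (hC z.1))
  rw [Measure.integral_compProd hi]
  simp only [integral_const_mul, act]

lemma integral_mul_act_comm [IsFiniteMeasure π] [IsMarkovKernel P] (hrev : P.IsReversible π)
    {f g : E → ℝ} (hf : Measurable f) (hg : Measurable g) {C D : ℝ} (hC : ∀ x, |f x| ≤ C)
    (hD : ∀ x, |g x| ≤ D) : ∫ x, f x * act P g x ∂π = ∫ x, g x * act P f x ∂π := by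
  rw [integral_mul_act hf hg hC hD, integral_mul_act hg hf hD hC,
    ← integral_swap_compProd hrev]
  simp [mul_comm]

lemma integral_act [IsFiniteMeasure π] [IsMarkovKernel P] (hrev : P.IsReversible π)
    {f : E → ℝ} (hf : Measurable f) {C : ℝ} (hC : ∀ x, |f x| ≤ C) :
    ∫ x, act P f x ∂π = ∫ x, f x ∂π := by
  have := integral_mul_act_comm hrev (f := fun _ => (1 : ℝ)) measurable_const hf (C := 1)
    (by simp) hC
  simpa [act] using this

lemma integral_sub_sq_compProd [IsFiniteMeasure π] [IsMarkovKernel P] (hrev : P.IsReversible π)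
    {f : E → ℝ} (hf : Measurable f) {C : ℝ} (hC : ∀ x, |f x| ≤ C) :
    ∫ z, (f z.1 - f z.2) ^ 2 ∂(π ⊗ₘ P) = 2 * (∫ x, f x ^ 2 ∂π - ∫ x, f x * act P f x ∂π) := by
  have hsq : ∀ x y, |f x * f y| ≤ C * C := fun x y => by
    rw [abs_mul]; exact mul_le_mul (hC _) (hC _) (abs_nonneg _) ((abs_nonneg _).trans (hC x))
  have h1 : Measurable fun z : E × E => f z.1 := hf.comp measurable_fst
  have h2 : Measurable fun z : E × E => f z.2 := hf.comp measurable_snd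
  have i1 : Integrable (fun z : E × E => f z.1 ^ 2) (π ⊗ₘ P) :=
    integrable_of_abs_le _ (h1.pow_const 2) (C := C * C) fun z => by simpa [sq] using hsq z.1 z.1
  have i2 : Integrable (fun z : E × E => f z.2 ^ 2) (π ⊗ₘ P) :=
    integrable_of_abs_le _ (h2.pow_const 2) (C := C * C) fun z => by simpa [sq] using hsq z.2 z.2
  have i3 : Integrable (fun z : E × E => f z.1 * f z.2) (π ⊗ₘ P) :=
    integrable_of_abs_le _ (h1.mul h2) (C := C * C) fun z => hsq z.1 z.2
  have e1 : ∫ z, f z.1 ^ 2 ∂(π ⊗ₘ P) = ∫ x, f x ^ 2 ∂π := integral_fst_compProd (hf.pow_const 2)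
  have e2 : ∫ z, f z.2 ^ 2 ∂(π ⊗ₘ P) = ∫ x, f x ^ 2 ∂π :=
    integral_snd_compProd hrev (hf.pow_const 2)
  calc ∫ z, (f z.1 - f z.2) ^ 2 ∂(π ⊗ₘ P)
      = ∫ z, (f z.1 ^ 2 + f z.2 ^ 2 - 2 * (f z.1 * f z.2)) ∂(π ⊗ₘ P) := by
        congr 1; ext z; ring
    _ = ∫ z, f z.1 ^ 2 ∂(π ⊗ₘ P) + ∫ z, f z.2 ^ 2 ∂(π ⊗ₘ P)
          - 2 * ∫ z, f z.1 * f z.2 ∂(π ⊗ₘ P) := by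
        rw [← integral_const_mul, ← integral_add i1 i2]
        exact integral_sub (i1.add i2) (i3.const_mul 2)
    _ = _ := by rw [e1, e2, integral_mul_act hf hf hC hC]; ring

/-- `‖Pf‖² ≤ ⟨f, Pf⟩` for positive reversible kernels. -/
lemma integral_act_sq_le [IsFiniteMeasure π] [IsMarkovKernel P] (hrev : P.IsReversible π)
    (hpos : IsPositive P π) {f : E → ℝ} (hf : Measurable f) {C : ℝ} (hC : ∀ x, |f x| ≤ C) :
    ∫ x, act P f x ^ 2 ∂π ≤ ∫ x, f x * act P f x ∂π := by
  set h := act P f with hh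
  have hm : Measurable h := measurable_act hf
  have hb : ∀ x, |h x| ≤ C := abs_act_le hC
  have hm2 : Measurable (act P h) := measurable_act hm
  have hb2 : ∀ x, |act P h x| ≤ C := abs_act_le hb
  have imul : ∀ {u v : E → ℝ}, Measurable u → Measurable v → (∀ x, |u x| ≤ C) →
      (∀ x, |v x| ≤ C) → Integrable (fun x => u x * v x) π := fun hu hv hu' hv' =>
    integrable_of_abs_le _ (hu.mul hv) (C := C * C) fun x => by
      rw [abs_mul]
      exact mul_le_mul (hu' _) (hv' _) (abs_nonneg _) ((abs_nonneg _).trans (hu' x))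
  -- Positivity at `f - Pf` gives `0 ≤ ⟨f, h⟩ - 2 ‖h‖² + ⟨h, Ph⟩` with `h = Pf`, and `⟨h, Ph⟩ ≤
  -- ‖h‖²` because the Dirichlet form of `h` is nonnegative. No spectral theory is involved.
  have p1 := hpos (fun x => f x - h x) (.of_bound (hf.sub hm).aestronglyMeasurable (C + C)
    (.of_forall fun x => (norm_sub_le _ _).trans (add_le_add (hC x) (hb x))))
  have p2 : ∫ x, (f x - h x) * act P (fun x => f x - h x) x ∂π
      = ∫ x, f x * h x ∂π - ∫ x, f x * act P h x ∂π - ∫ x, h x * h x ∂π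
        + ∫ x, h x * act P h x ∂π := by
    have j1 := imul hf hm hC hb
    have j2 := imul hf hm2 hC hb2
    have j3 := imul hm hm hb hb
    have j4 := imul hm hm2 hb hb2
    have j12 : Integrable (fun x => f x * h x - f x * act P h x) π := j1.sub j2
    have j123 : Integrable (fun x => f x * h x - f x * act P h x - h x * h x) π := j12.sub j3
    rw [← integral_sub j1 j2, ← integral_sub j12 j3, ← integral_add j123 j4]
    refine integral_congr_ae (.of_forall fun x => ?_)
    simp only
    rw [act_sub hf hm hC hb, ← hh]
    ring
  have p3 : ∫ x, f x * act P h x ∂π = ∫ x, h x * h x ∂π :=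
    integral_mul_act_comm hrev hf hm hC hb
  have p4 : 0 ≤ ∫ z, (h z.1 - h z.2) ^ 2 ∂(π ⊗ₘ P) := integral_nonneg fun z => sq_nonneg _
  rw [integral_sub_sq_compProd hrev hm hb] at p4
  simp only [sq] at p4 ⊢
  linarith

lemma variance_act_le [IsProbabilityMeasure π] [IsMarkovKernel P] (hrev : P.IsReversible π)
    (hpos : IsPositive P π) {f : E → ℝ} (hf : Measurable f) {C : ℝ} (hC : ∀ x, |f x| ≤ C) :
    Var[act P f; π] ≤ Var[f; π] - (∫ z, (f z.1 - f z.2) ^ 2 ∂(π ⊗ₘ P)) / 2 := by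
  rw [variance_eq_sub (.of_bound (measurable_act hf).aestronglyMeasurable C
      (.of_forall (abs_act_le hC))), variance_eq_sub (.of_bound hf.aestronglyMeasurable C
      (.of_forall hC)), integral_act hrev hf hC, integral_sub_sq_compProd hrev hf hC]
  have := integral_act_sq_le hrev hpos hf hC
  simp only [Pi.pow_apply]
  linarith

lemma isMarkovKernel_pow [IsMarkovKernel P] (n : ℕ) : IsMarkovKernel (P ^ n) := by
  induction n with
  | zero => exact inferInstanceAs (IsMarkovKernel Kernel.id)
  | succ n ih =>
    rw [Kernel.pow_add, pow_one]
    infer_instance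

lemma act_pow [IsMarkovKernel P] (n : ℕ) {f : E → ℝ} (hf : Measurable f) {C : ℝ}
    (hC : ∀ x, |f x| ≤ C) : act (P ^ n) f = (act P)^[n] f := by
  induction n with
  | zero =>
    ext x
    change ∫ y, f y ∂(Kernel.id x) = f x
    rw [Kernel.id_apply, integral_dirac' f x hf.stronglyMeasurable]
  | succ n ih =>
    have := isMarkovKernel_pow (P := P) n
    ext x
    rw [Function.iterate_succ_apply', ← ih]
    simp only [act, Kernel.pow_add, pow_one]
    exact Kernel.integral_comp (integrable_of_abs_le _ hf hC)

end Action

/-! ### Comparison of a discrete recursion with an integral -/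

section Recursion

/-- A sequence whose decrements dominate `1 / w` drops to `η` within the time given by the
integral of `w`. -/
lemma natCast_le_integral_of_decrement {w : ℝ → ℝ} {β : ℝ} (hw : ContinuousOn w (Ioc 0 β))
    (hanti : AntitoneOn w (Ioc 0 β)) {b : ℕ → ℝ} (hb : Antitone b) (hb0 : b 0 ≤ β) {n : ℕ}
    (hpos : 0 < b n)
    (hstep : ∀ k < n, 1 ≤ (b k - b (k + 1)) * w (b k)) :
    (n : ℝ) ≤ ∫ t in (b n)..(b 0), w t := by
  have hmem : ∀ k ≤ n, b k ∈ Ioc 0 β := fun k hk =>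
    ⟨hpos.trans_le (hb hk), (hb (Nat.zero_le k)).trans hb0⟩
  have hint : ∀ {x y}, 0 < x → x ≤ y → y ≤ β → IntervalIntegrable w volume x y :=
    fun hx hxy hy => (hw.mono fun t ht => by
      rw [uIcc_of_le hxy] at ht
      exact ⟨hx.trans_le ht.1, ht.2.trans hy⟩).intervalIntegrable
  induction n with
  | zero => simp
  | succ n ih =>
    have h0 := ih (hpos.trans_le (hb n.le_succ)) (fun k hk => hstep k (by omega))
      fun k hk => hmem k (by omega)
    have m1 := hmem n (by omega)
    have m0 := hmem 0 (by omega)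
    -- Since `w` decreases, its value at the right endpoint is its minimum over the interval.
    have h1 : (b n - b (n + 1)) * w (b n) ≤ ∫ t in (b (n + 1))..(b n), w t := by
      have := intervalIntegral.integral_mono_on (a := b (n + 1)) (b := b n) (hb n.le_succ)
        (f := fun _ => w (b n)) (g := w) (by simp) (hint hpos (hb n.le_succ) m1.2) fun t ht =>
          hanti ⟨hpos.trans_le ht.1, ht.2.trans m1.2⟩ m1 ht.2
      simpa using this
    have h2 := intervalIntegral.integral_add_adjacent_intervals
      (hint hpos (hb n.le_succ) m1.2) (hint m1.1 (hb (Nat.zero_le n)) hb0)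
    have := hstep n (by omega)
    push_cast
    linarith

end Recursion

/-! ### Variance decay for functions with values in `[0,1]` -/

section Mixing

lemma variance_le_quarter {E : Type*} [MeasurableSpace E] {π : Measure E} [IsProbabilityMeasure π]
    {f : E → ℝ} (hf : Measurable f) (h01 : ∀ x, f x ∈ Icc (0 : ℝ) 1) :
    Var[f; π] ≤ 1 / 4 := by
  have := variance_le_sq_of_bounded (μ := π) (.of_forall h01) hf.aemeasurable
  norm_num at this ⊢
  exact this

variable {E : Type*} [MetricSpace E] [MeasurableSpace E] [OpensMeasurableSpace E]
  {π : Measure E} [IsProbabilityMeasure π] {I : ℝ → ℝ} {P : Kernel E E} [IsMarkovKernel P]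
  {δ ε : ℝ}

lemma variance_act_add_le (hI : IsIsoMinorant π I) (hreg : IsRegular I)
    (hconv : ConvexOn ℝ (Ioc 0 (1 / 2)) I)
    (hzero : (∃ (x : E) (r : ℝ), π (Metric.closedBall x r) = 1) → Tendsto I (𝓝[>] 0) (𝓝 0))
    (hrev : P.IsReversible π) (hpos : IsPositive P π) (hcc : IsCloseCoupling P δ ε)
    (hδ : 2 * δ * I (1 / 4) ≤ 1) {f : E → ℝ} (hf : Measurable f)
    (h01 : ∀ x, f x ∈ Icc (0 : ℝ) 1) (hv : 0 < Var[f; π]) :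
    Var[act P f; π] + (ε * δ * I (Var[f; π] / 8)) ^ 2 / (4 * Var[f; π]) ≤ Var[f; π] := by
  set v := Var[f; π] with hvdef
  have hv4 : v ≤ 1 / 4 := variance_le_quarter hf h01
  have hδ0 := hcc.1
  have hε0 := hcc.2.1
  have hIv := (hI (v / 8) ⟨by linarith, by linarith⟩).1
  have e1 : v / 4 / 2 = v / 8 := by ring
  have e2 : 4 * (v / 4) = v := by ring
  -- With `s = v/4`, half of the variance survives the defect `2 s`, and `κ` involves `I(s/2) =
  -- I(v/8)`.
  have h1 := weak_cheeger hrev (κ := ε * δ * I (v / 8) / v) (s := v / 4) (by positivity)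
    (by positivity) (fun A hA hA2 => by
      have := conductance_le hI hreg hconv hzero hrev hcc hδ (s := v / 4) (by positivity)
        (by linarith) hA hA2
      rwa [e1, e2] at this) hf h01
  have h2 := variance_act_le hrev hpos hf (C := 1) fun x =>
    abs_le.2 ⟨by linarith [(h01 x).1], (h01 x).2⟩
  rw [← hvdef] at h1 h2
  have e3 : (ε * δ * I (v / 8) / v) ^ 2 * (v - 2 * (v / 4)) =
      2 * ((ε * δ * I (v / 8)) ^ 2 / (4 * v)) := by
    field_simp; ring
  rw [e3] at h1
  linarith

theorem variance_iterate_act_le (hI : IsIsoMinorant π I) (hreg : IsRegular I)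
    (hconv : ConvexOn ℝ (Ioc 0 (1 / 2)) I)
    (hzero : (∃ (x : E) (r : ℝ), π (Metric.closedBall x r) = 1) → Tendsto I (𝓝[>] 0) (𝓝 0))
    (hrev : P.IsReversible π) (hpos : IsPositive P π) (hcc : IsCloseCoupling P δ ε)
    (hδ : 2 * δ * I (1 / 4) ≤ 1) {f : E → ℝ} (hf : Measurable f)
    (h01 : ∀ x, f x ∈ Icc (0 : ℝ) 1) {e : ℝ} (he : 0 < e) {n : ℕ}
    (hn : 1 + 2 ^ 8 / (ε ^ 2 * δ ^ 2) * (∫ v in (e / 2 ^ 3)..(1 / 2 ^ 5), v / I v ^ 2) ≤ n) :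
    Var[(act P)^[n] f; π] ≤ e := by
  by_contra! hlt
  have hδ0 := hcc.1
  have hε0 := hcc.2.1
  have hit : ∀ k, Measurable ((act P)^[k] f) ∧ ∀ x, (act P)^[k] f x ∈ Icc (0 : ℝ) 1 := by
    intro k
    induction k with
    | zero => exact ⟨hf, h01⟩
    | succ k ih =>
      rw [Function.iterate_succ_apply']
      exact ⟨measurable_act ih.1, act_mem_Icc ih.2⟩
  -- Dividing by 8 makes `b k` the argument of `I`. Variance at most `1/4` gives `b 0 ≤ 2⁻⁵`, and
  -- the negated goal gives `b n > e/8`; these are the limits of integration.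
  set b : ℕ → ℝ := fun k => Var[(act P)^[k] f; π] / 8 with hb
  have hanti : Antitone b := by
    refine antitone_nat_of_succ_le fun k => ?_
    have h2 := variance_act_le hrev hpos (hit k).1 (C := 1) fun x =>
      abs_le.2 ⟨by linarith [((hit k).2 x).1], ((hit k).2 x).2⟩
    have h3 : 0 ≤ ∫ z, ((act P)^[k] f z.1 - (act P)^[k] f z.2) ^ 2 ∂(π ⊗ₘ P) :=
      integral_nonneg fun z => sq_nonneg _
    simp only [hb, Function.iterate_succ_apply']
    linarith
  have hIpos : ∀ t ∈ Ioc (0 : ℝ) (1 / 2 ^ 5), 0 < I t := fun t ht =>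
    (hI t ⟨ht.1, by norm_num at ht ⊢; linarith [ht.2]⟩).1
  set C := 2 ^ 8 / (ε ^ 2 * δ ^ 2) with hC
  have hC0 : 0 < C := by positivity
  have hbn : e / 2 ^ 3 < b n := by simp only [hb]; norm_num; linarith
  have hbn0 : 0 < b n := lt_trans (by positivity) hbn
  have hb0 : b 0 ≤ 1 / 2 ^ 5 := by
    have : Var[(act P)^[0] f; π] ≤ 1 / 4 := variance_le_quarter hf h01
    simp only [hb]; norm_num at this ⊢; linarith
  have hcont : ContinuousOn (fun v => v / I v ^ 2) (Ioc 0 (1 / 2 ^ 5)) := by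
    refine continuousOn_id.div ((hreg.cont.mono fun t ht => ?_).pow 2) fun t ht =>
      pow_ne_zero 2 (hIpos t ht).ne'
    exact ⟨ht.1, ht.2.trans_lt (by norm_num)⟩
  -- `v / I v ^ 2` is the product of `v / I v` and `1 / I v`, both decreasing.
  have hw : AntitoneOn (fun v => C * (v / I v ^ 2)) (Ioc 0 (1 / 2 ^ 5)) := by
    intro q hq p hp hqp
    have hp2 : p ≤ 1 / 2 := hp.2.trans (by norm_num)
    have h1 := hI.ratio_mono hreg hconv hzero hq.1 hqp hp2
    have h2 := hreg.mono ⟨hq.1, hqp.trans hp2⟩ ⟨hp.1, hp2⟩ hqp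
    have hIq := hIpos q hq
    have hIp := hIpos p hp
    refine mul_le_mul_of_nonneg_left ?_ hC0.le
    rw [div_le_div_iff₀ (by positivity) (by positivity)]
    have h3 := mul_le_mul h1 h2 hIq.le (mul_pos hq.1 hIp).le
    nlinarith
  have h1 := natCast_le_integral_of_decrement (hcont.const_mul C |>.congr fun _ _ => rfl) hw hanti
    hb0 hbn0 (fun k hk => by
      have hk0 : 0 < b k := hbn0.trans_le (hanti hk.le)
      have hv0 : 0 < Var[(act P)^[k] f; π] := by simp only [hb] at hk0; linarith
      have := variance_act_add_le hI hreg hconv hzero hrev hpos hcc hδ (hit k).1 (hit k).2 hv0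
      rw [← Function.iterate_succ_apply' (act P)] at this
      have hIk := hIpos (b k) ⟨hk0, (hanti (Nat.zero_le k)).trans hb0⟩
      have e1 : Var[(act P)^[k] f; π] = 8 * b k := by simp only [hb]; ring
      have e2 : Var[(act P)^[k + 1] f; π] = 8 * b (k + 1) := by simp only [hb]; ring
      rw [e1, e2, mul_div_cancel_left₀ _ (by norm_num : (8 : ℝ) ≠ 0)] at this
      -- The denominator is `4 * 8 * 8 = 2⁸` times `b k`, the source of the constant in the theorem.
      have h4 : (ε * δ * I (b k)) ^ 2 / (4 * (8 * b k)) / 8 ≤ b k - b (k + 1) := by linarith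
      refine le_trans (le_of_eq ?_) (mul_le_mul_of_nonneg_right h4 (by positivity))
      rw [hC]; field_simp; norm_num)
  have hii : ∀ {x y}, 0 < x → x ≤ y → y ≤ 1 / 2 ^ 5 →
      IntervalIntegrable (fun v => v / I v ^ 2) volume x y :=
    fun hx hxy hy => (hcont.mono fun t ht => by
      rw [uIcc_of_le hxy] at ht
      exact ⟨hx.trans_le ht.1, ht.2.trans hy⟩).intervalIntegrable
  have h2 : ∫ v in (b n)..(b 0), v / I v ^ 2 ≤ ∫ v in (e / 2 ^ 3)..(1 / 2 ^ 5), v / I v ^ 2 := by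
    refine intervalIntegral.integral_mono_interval hbn.le (hanti (Nat.zero_le n)) hb0 ?_
      (hii (by positivity) (hbn.le.trans ((hanti (Nat.zero_le n)).trans hb0)) le_rfl)
    refine (ae_restrict_mem measurableSet_Ioc).mono fun t ht => ?_
    have ht0 : 0 < t := lt_trans (by positivity) ht.1
    exact div_nonneg ht0.le (sq_nonneg _)
  rw [intervalIntegral.integral_const_mul] at h1
  have h3 := mul_le_mul_of_nonneg_left h2 hC0.le
  linarith

end Mixing

/-! ### Normalising functions of finite oscillation -/

section Oscillation

variable {E : Type*} [MeasurableSpace E] {π : Measure E}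

lemma exists_ae_mem_Icc [IsProbabilityMeasure π] {f : E → ℝ} {c : ℝ} (hc : 0 ≤ c)
    (h : oscNorm π f ≤ ENNReal.ofReal c) : ∃ a, ∀ᵐ x ∂π, f x ∈ Icc a (a + c) := by
  have hS : ∀ᵐ x ∂π, (f x : EReal) ≤ essSup (fun x => (f x : EReal)) π := ae_le_essSup
  have hT : ∀ᵐ x ∂π, essInf (fun x => (f x : EReal)) π ≤ (f x : EReal) := ae_essInf_le
  rw [oscNorm] at h
  generalize essSup (fun x => (f x : EReal)) π = S at *
  generalize essInf (fun x => (f x : EReal)) π = T at *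
  obtain ⟨x, hxS, hxT⟩ := (hS.and hT).exists
  have hS0 : S ≠ ⊥ := ((EReal.bot_lt_coe _).trans_le hxS).ne'
  have hT0 : T ≠ ⊤ := (hxT.trans_lt (EReal.coe_lt_top _)).ne
  have hT1 : T ≠ ⊥ := by
    rintro rfl
    rw [EReal.sub_bot hS0, EReal.toENNReal_top, top_le_iff] at h
    exact ENNReal.ofReal_ne_top h
  have hS1 : S ≠ ⊤ := by
    rintro rfl
    rw [EReal.top_sub hT0, EReal.toENNReal_top, top_le_iff] at h
    exact ENNReal.ofReal_ne_top h
  lift S to ℝ using ⟨hS1, hS0⟩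
  lift T to ℝ using ⟨hT0, hT1⟩
  rw [← EReal.coe_sub, EReal.toENNReal_of_ne_top (EReal.coe_ne_top _), EReal.toReal_coe,
    ENNReal.ofReal_le_ofReal_iff hc] at h
  refine ⟨T, ?_⟩
  filter_upwards [hS, hT] with y h1 h2
  rw [EReal.coe_le_coe_iff] at h1 h2
  exact ⟨h2, by linarith⟩

/-- Supplies a measurable representative bounded everywhere, as the pointwise hypotheses of the
variance bounds require. Clamping to `[0,1]` changes nothing almost everywhere; for `c = 0` the
function is almost everywhere `a`. -/
lemma exists_ae_eq_affine {f : E → ℝ} (hf : AEStronglyMeasurable f π) {a c : ℝ} (hc : 0 ≤ c)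
    (h : ∀ᵐ x ∂π, f x ∈ Icc a (a + c)) :
    ∃ g : E → ℝ, Measurable g ∧ (∀ x, g x ∈ Icc (0 : ℝ) 1) ∧ f =ᵐ[π] fun x => a + c * g x := by
  obtain ⟨f', hf', hff'⟩ := hf.aemeasurable
  refine ⟨fun x => max 0 (min 1 ((f' x - a) / c)),
    measurable_const.max (measurable_const.min ((hf'.sub_const a).div_const c)),
    fun x => ⟨le_max_left _ _, max_le zero_le_one (min_le_left _ _)⟩, ?_⟩
  filter_upwards [h, hff'] with x h1 h2
  rw [h2] at h1 ⊢
  rcases hc.eq_or_lt with rfl | hc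
  · simp only [add_zero, Icc_self, mem_singleton_iff] at h1
    simp [h1]
  · have h3 : 0 ≤ (f' x - a) / c := div_nonneg (by linarith [h1.1]) hc.le
    have h4 : (f' x - a) / c ≤ 1 := (div_le_one hc).2 (by linarith [h1.2])
    rw [min_eq_right h4, max_eq_right h3]
    field_simp
    ring

lemma evariance_eq_eLpNorm_sq {Ω : Type*} [MeasurableSpace Ω] (μ : Measure Ω) (X : Ω → ℝ) :
    eLpNorm (fun x => X x - ∫ y, X y ∂μ) 2 μ ^ 2 = eVar[X; μ] := by
  rw [evariance, eLpNorm_eq_lintegral_rpow_enorm_toReal two_ne_zero ENNReal.ofNat_ne_top,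
    ← ENNReal.rpow_two, ← ENNReal.rpow_mul]
  simp

end Oscillation

/-! ### Invariance and evolution of densities -/

section Densities

variable {E : Type*} [MeasurableSpace E] {π : Measure E} {P : Kernel E E}

lemma invariant_pow [IsMarkovKernel P] (hrev : P.IsReversible π) (n : ℕ) :
    π.bind (P ^ n) = π := by
  induction n with
  | zero => exact Measure.id_comp
  | succ n ih => rw [Kernel.pow_add, pow_one, ← Measure.comp_assoc, hrev.invariant.def, ih]

/-- By invariance of `π`, a `π`-null set is null for `(P ^ n) x` for `π`-almost every `x`. -/
lemma act_pow_congr [IsMarkovKernel P] (hrev : P.IsReversible π) (n : ℕ) {f g : E → ℝ}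
    (h : f =ᵐ[π] g) : act (P ^ n) f =ᵐ[π] act (P ^ n) g := by
  rw [← invariant_pow hrev n] at h
  filter_upwards [Measure.ae_ae_of_ae_comp h] with x hx
  exact integral_congr_ae hx

lemma integral_iterate_act [IsFiniteMeasure π] [IsMarkovKernel P] (hrev : P.IsReversible π)
    (n : ℕ) {f : E → ℝ} (hf : Measurable f) {C : ℝ} (hC : ∀ x, |f x| ≤ C) :
    ∫ x, (act P)^[n] f x ∂π = ∫ x, f x ∂π := by
  induction n generalizing f with
  | zero => rfl
  | succ n ih =>
    rw [Function.iterate_succ_apply, ih (measurable_act hf) (abs_act_le hC),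
      integral_act hrev hf hC]

lemma act_affine [IsMarkovKernel P] {g : E → ℝ} (hg : Measurable g) {C : ℝ}
    (hC : ∀ x, |g x| ≤ C) (a c : ℝ) (x : E) :
    act P (fun y => a + c * g y) x = a + c * act P g x := by
  simp only [act]
  rw [integral_add (integrable_const _) ((integrable_of_abs_le _ hg hC).const_mul c),
    integral_const_mul]
  simp

/-- Self-adjointness in dual form: swapping the coordinates of `π ⊗ₘ P` moves the kernel from the
measure to its density. -/
lemma bind_withDensity [IsFiniteMeasure π] [IsMarkovKernel P] (hrev : P.IsReversible π)
    {f : E → ℝ} (hf : Measurable f) (h0 : ∀ x, 0 ≤ f x) {C : ℝ} (hC : ∀ x, |f x| ≤ C) :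
    (π.withDensity fun x => ENNReal.ofReal (f x)).bind P =
      π.withDensity fun x => ENNReal.ofReal (act P f x) := by
  ext s hs
  have hfm : Measurable fun x => ENNReal.ofReal (f x) := hf.ennreal_ofReal
  have hF : Measurable fun z : E × E =>
      ENNReal.ofReal (f z.1) * s.indicator (fun _ => (1 : ℝ≥0∞)) z.2 :=
    (hfm.comp measurable_fst).mul ((measurable_const.indicator hs).comp measurable_snd)
  rw [Measure.bind_apply hs P.aemeasurable, withDensity_apply _ hs,
    lintegral_withDensity_eq_lintegral_mul _ hfm (P.measurable_coe hs)]
  calc ∫⁻ x, ENNReal.ofReal (f x) * P x s ∂π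
      = ∫⁻ z, ENNReal.ofReal (f z.1) * s.indicator (fun _ => (1 : ℝ≥0∞)) z.2 ∂(π ⊗ₘ P) := by
        rw [Measure.lintegral_compProd hF]
        refine lintegral_congr fun x => ?_
        simp only
        rw [lintegral_const_mul _ (measurable_const.indicator hs), lintegral_indicator_const hs,
          one_mul]
    _ = ∫⁻ z, ENNReal.ofReal (f z.2) * s.indicator (fun _ => (1 : ℝ≥0∞)) z.1 ∂(π ⊗ₘ P) := by
        conv_lhs => rw [← map_swap_compProd hrev]
        rw [lintegral_map hF measurable_swap]
        rfl
    _ = ∫⁻ x in s, ENNReal.ofReal (act P f x) ∂π := by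
        have hF' : Measurable fun z : E × E =>
            ENNReal.ofReal (f z.2) * s.indicator (fun _ => (1 : ℝ≥0∞)) z.1 :=
          (hfm.comp measurable_snd).mul ((measurable_const.indicator hs).comp measurable_fst)
        rw [Measure.lintegral_compProd hF', ← lintegral_indicator hs]
        refine lintegral_congr fun x => ?_
        simp only
        have h1 : ENNReal.ofReal (act P f x) = ∫⁻ y, ENNReal.ofReal (f y) ∂(P x) :=
          ofReal_integral_eq_lintegral_ofReal (integrable_of_abs_le _ hf hC) (.of_forall h0)
        rw [lintegral_mul_const _ hfm, ← h1]
        by_cases hx : x ∈ s <;> simp [hx]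

lemma bind_pow_withDensity [IsFiniteMeasure π] [IsMarkovKernel P] (hrev : P.IsReversible π)
    (n : ℕ) {f : E → ℝ} (hf : Measurable f) (h0 : ∀ x, 0 ≤ f x) {C : ℝ} (hC : ∀ x, |f x| ≤ C) :
    (π.withDensity fun x => ENNReal.ofReal (f x)).bind (P ^ n) =
      π.withDensity fun x => ENNReal.ofReal ((act P)^[n] f x) := by
  induction n generalizing f with
  | zero => exact Measure.id_comp
  | succ n ih =>
    rw [Kernel.pow_add, pow_one, ← Measure.comp_assoc, bind_withDensity hrev hf h0 hC,
      ih (measurable_act hf) (fun x => integral_nonneg h0) (abs_act_le hC)]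
    rfl

end Densities

/-! ### The two mixing bounds -/

theorem mixing_time_osc {E : Type*} [MetricSpace E] [MeasurableSpace E] [OpensMeasurableSpace E]
    {π : Measure E} [IsProbabilityMeasure π] {I : ℝ → ℝ} (hI : IsIsoMinorant π I)
    (hreg : IsRegular I) (hconv : ConvexOn ℝ (Ioc 0 (1 / 2)) I)
    (hzero : (∃ (x : E) (r : ℝ), π (Metric.closedBall x r) = 1) → Tendsto I (𝓝[>] 0) (𝓝 0))
    {P : Kernel E E} [IsMarkovKernel P] {δ ε : ℝ} (hrev : P.IsReversible π)
    (hpos : IsPositive P π) (hcc : IsCloseCoupling P δ ε) (hδ : 2 * δ * I (1 / 4) ≤ 1) {e : ℝ}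
    (he : 0 < e) {n : ℕ}
    (hn : 1 + 2 ^ 8 / (ε ^ 2 * δ ^ 2) * (∫ v in (e / 2 ^ 3)..(1 / 2 ^ 5), v / I v ^ 2) ≤ n)
    {f : E → ℝ} (hf : MemLp f 2 π) (hosc : oscNorm π f ^ 2 ≤ 1) :
    eLpNorm (fun x => act (P ^ n) f x - ∫ y, f y ∂π) 2 π ^ 2 ≤ ENNReal.ofReal e := by
  have hosc' : oscNorm π f ≤ ENNReal.ofReal 1 := by
    rw [ENNReal.ofReal_one]
    by_contra! h
    exact absurd hosc (not_le.2 (one_lt_pow₀ h two_ne_zero))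
  obtain ⟨a, ha⟩ := exists_ae_mem_Icc zero_le_one hosc'
  obtain ⟨g, hg, h01, hfg⟩ := exists_ae_eq_affine hf.1 zero_le_one ha
  have hgb : ∀ x, |g x| ≤ 1 := fun x => abs_le.2 ⟨by linarith [(h01 x).1], (h01 x).2⟩
  have hMk := isMarkovKernel_pow (P := P) n
  set h := act (P ^ n) g with hh
  have hint : ∫ x, f x ∂π = a + ∫ x, h x ∂π := by
    have : ∫ x, h x ∂π = ∫ x, g x ∂π := by
      rw [hh, act_pow n hg hgb, integral_iterate_act hrev n hg hgb]
    rw [integral_congr_ae hfg, integral_add (integrable_const _)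
      ((integrable_of_abs_le _ hg hgb).const_mul 1), integral_const_mul, this]
    simp
  have hcongr : (fun x => act (P ^ n) f x - ∫ y, f y ∂π) =ᵐ[π] fun x => h x - ∫ y, h y ∂π := by
    filter_upwards [act_pow_congr hrev n hfg] with x hx
    rw [hx, act_affine hg hgb, hint, ← hh]
    ring
  rw [eLpNorm_congr_ae hcongr, evariance_eq_eLpNorm_sq, ← ofReal_variance
    (.of_bound (measurable_act hg).aestronglyMeasurable 1 (.of_forall (abs_act_le hgb)))]
  refine ENNReal.ofReal_le_ofReal ?_
  rw [act_pow n hg hgb]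
  exact variance_iterate_act_le hI hreg hconv hzero hrev hpos hcc hδ hg h01 he hn

theorem mixing_time_chiSq {E : Type*} [MetricSpace E] [MeasurableSpace E]
    [OpensMeasurableSpace E]
    {π : Measure E} [IsProbabilityMeasure π] {I : ℝ → ℝ} (hI : IsIsoMinorant π I)
    (hreg : IsRegular I) (hconv : ConvexOn ℝ (Ioc 0 (1 / 2)) I)
    (hzero : (∃ (x : E) (r : ℝ), π (Metric.closedBall x r) = 1) → Tendsto I (𝓝[>] 0) (𝓝 0))
    {P : Kernel E E} [IsMarkovKernel P] {δ ε : ℝ} (hrev : P.IsReversible π)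
    (hpos : IsPositive P π) (hcc : IsCloseCoupling P δ ε) (hδ : 2 * δ * I (1 / 4) ≤ 1)
    {ν : Measure E} [IsProbabilityMeasure ν] (hν : ν ≪ π) {u : ℝ}
    (hosc : oscNorm π (fun x => (ν.rnDeriv π x).toReal) ^ 2 = ENNReal.ofReal u) (hu : 0 ≤ u)
    {e : ℝ} (he : 0 < e) {n : ℕ} (hn : u = 0 ∨
      1 + 2 ^ 8 / (ε ^ 2 * δ ^ 2) * (∫ v in (e / (2 ^ 3 * u))..(1 / 2 ^ 5), v / I v ^ 2) ≤ n) :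
    chiSq (ν.bind (P ^ n)) π ≤ ENNReal.ofReal e := by
  set c := √u with hc
  have hc0 : 0 ≤ c := Real.sqrt_nonneg u
  have hcu : c ^ 2 = u := Real.sq_sqrt hu
  have hosc' : oscNorm π (fun x => (ν.rnDeriv π x).toReal) ≤ ENNReal.ofReal c := by
    rw [← hcu, ENNReal.ofReal_pow hc0] at hosc
    exact (ENNReal.pow_le_pow_left_iff two_ne_zero).1 hosc.le
  obtain ⟨a, ha⟩ := exists_ae_mem_Icc hc0 hosc'
  -- A density is nonnegative, so the lower endpoint can be raised to `max a 0`; the representative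
  -- `f` is then nonnegative everywhere and `ENNReal.ofReal` truncates nothing.
  have ha' : ∀ᵐ x ∂π, (ν.rnDeriv π x).toReal ∈ Icc (max a 0) (max a 0 + c) := by
    filter_upwards [ha] with x hx
    exact ⟨max_le hx.1 ENNReal.toReal_nonneg, hx.2.trans (by gcongr; exact le_max_left _ _)⟩
  set a' := max a 0
  have ha0 : 0 ≤ a' := le_max_right _ _
  obtain ⟨g, hg, h01, hfg⟩ := exists_ae_eq_affine
    (Measure.measurable_rnDeriv ν π).ennreal_toReal.aestronglyMeasurable hc0 ha'
  have hgb : ∀ x, |g x| ≤ 1 := fun x => abs_le.2 ⟨by linarith [(h01 x).1], (h01 x).2⟩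
  have hMk := isMarkovKernel_pow (P := P) n
  set f : E → ℝ := fun x => a' + c * g x with hf
  have hfm : Measurable f := (hg.const_mul c).const_add a'
  have hf0 : ∀ x, 0 ≤ f x := fun x => add_nonneg ha0 (mul_nonneg hc0 (h01 x).1)
  have hfb : ∀ x, |f x| ≤ a' + c := fun x => by
    rw [abs_of_nonneg (hf0 x)]
    have := mul_le_mul_of_nonneg_left (h01 x).2 hc0
    simp only [hf]; linarith
  set h := (act P)^[n] g with hh
  have hact : (act P)^[n] f = fun x => a' + c * h x := by
    rw [← act_pow n hfm hfb, hh, ← act_pow n hg hgb]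
    ext x
    exact act_affine hg hgb a' c x
  have hνf : ν = π.withDensity fun x => ENNReal.ofReal (f x) := by
    refine (Measure.withDensity_rnDeriv_eq ν π hν).symm.trans (withDensity_congr_ae ?_)
    filter_upwards [hfg, Measure.rnDeriv_ne_top ν π] with x hx hx'
    rw [← hx, ENNReal.ofReal_toReal hx']
  have hbind := bind_pow_withDensity hrev n hfm hf0 hfb
  rw [← hνf, hact] at hbind
  have hhm : Measurable h := by rw [hh, ← act_pow n hg hgb]; exact measurable_act hg
  have hh0 : ∀ x, 0 ≤ h x := by
    rw [hh, ← act_pow n hg hgb]; exact fun x => integral_nonneg fun y => (h01 y).1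
  have hhb : ∀ x, |h x| ≤ 1 := by rw [hh, ← act_pow n hg hgb]; exact abs_act_le hgb
  have hkm : Measurable fun x => a' + c * h x := (hhm.const_mul c).const_add a'
  have hac : ν.bind (P ^ n) ≪ π := by rw [hbind]; exact withDensity_absolutelyContinuous _ _
  rw [chiSq, if_pos hac]
  have hrn : (fun x => ((ν.bind (P ^ n)).rnDeriv π x).toReal) =ᵐ[π] fun x => a' + c * h x := by
    rw [hbind]
    filter_upwards [Measure.rnDeriv_withDensity π hkm.ennreal_ofReal] with x hx
    rw [hx, ENNReal.toReal_ofReal (add_nonneg ha0 (mul_nonneg hc0 (hh0 x)))]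
  have hmem : MemLp h 2 π := .of_bound hhm.aestronglyMeasurable 1 (.of_forall hhb)
  have hmem' : MemLp (fun x => a' + c * h x) 2 π := (memLp_const a').add (hmem.const_mul c)
  rw [evariance_congr hrn, ← ofReal_variance hmem']
  refine ENNReal.ofReal_le_ofReal ?_
  rw [variance_const_add (hhm.const_mul c).aestronglyMeasurable, variance_const_mul, hcu]
  -- The divergence is now `u * Var[h; π]`, so `h` needs variance at most `e / u`; for `u = 0` there
  -- is nothing to decay.
  rcases hu.eq_or_lt with rfl | hu0
  · simpa using he.le
  · have hn' := hn.resolve_left hu0.ne'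
    have e1 : e / (2 ^ 3 * u) = e / u / 2 ^ 3 := by rw [div_div, mul_comm]
    rw [e1] at hn'
    have := variance_iterate_act_le hI hreg hconv hzero hrev hpos hcc hδ hg h01
      (div_pos he hu0) hn'
    calc u * Var[h; π] ≤ u * (e / u) := by gcongr
      _ = e := by field_simp

end CloseCouplingMixing

theorem mainTheorem6 {E : Type*} [MetricSpace E] [MeasurableSpace E] [OpensMeasurableSpace E]
    (π : Measure E) [IsProbabilityMeasure π] (I : ℝ → ℝ)
    (hI : CloseCouplingMixing.IsIsoMinorant π I)
    (hreg : CloseCouplingMixing.IsRegular I)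
    (hconv : ConvexOn ℝ (Ioc 0 (1 / 2)) I)
    (hzero : (∃ (x : E) (r : ℝ), π (Metric.closedBall x r) = 1) → Tendsto I (𝓝[>] 0) (𝓝 0))
    (P : Kernel E E) [IsMarkovKernel P] (δ ε : ℝ)
    (hrev : P.IsReversible π)
    (hpos : CloseCouplingMixing.IsPositive P π)
    (hcc : CloseCouplingMixing.IsCloseCoupling P δ ε)
    (hδ : 2 * δ * I (1 / 4) ≤ 1) :
    (∀ εMix ∈ Ioo (0 : ℝ) (1 / 4), ∀ n : ℕ,
      1 + 2 ^ 8 / (ε ^ 2 * δ ^ 2) * (∫ v in (εMix / 2 ^ 3)..(1 / 2 ^ 5), v / I v ^ 2) ≤ (n : ℝ) →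
      (⨆ (f : E → ℝ) (_ : MemLp f 2 π) (_ : CloseCouplingMixing.oscNorm π f ^ 2 ≤ 1),
        eLpNorm (fun x => CloseCouplingMixing.act (P ^ n) f x - ∫ y, f y ∂π) 2 π ^ 2)
          ≤ ENNReal.ofReal εMix) ∧
    (∀ (ν : Measure E) [IsProbabilityMeasure ν], ν ≪ π →
      ∀ u : ℝ,
      CloseCouplingMixing.oscNorm π (fun x => (ν.rnDeriv π x).toReal) ^ 2 = ENNReal.ofReal u →
      0 ≤ u → ∀ εMix : ℝ, 0 < εMix → ∀ n : ℕ,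
      (u = 0 ∨
        1 + 2 ^ 8 / (ε ^ 2 * δ ^ 2) * (∫ v in (εMix / (2 ^ 3 * u))..(1 / 2 ^ 5), v / I v ^ 2)
          ≤ (n : ℝ)) →
      CloseCouplingMixing.chiSq (ν.bind (P ^ n)) π ≤ ENNReal.ofReal εMix) := by
  refine ⟨fun e he n hn => iSup_le fun f => iSup_le fun hf => iSup_le fun hosc =>
    CloseCouplingMixing.mixing_time_osc hI hreg hconv hzero hrev hpos hcc hδ he.1 hn hf hosc,
    fun ν _ hν u hosc hu e he n hn =>
    CloseCouplingMixing.mixing_time_chiSq hI hreg hconv hzero hrev hpos hcc hδ hν hosc hu he hn⟩
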